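/- Let $p$ be a prime number and $e \ge 1$ an integer. Let $\mathcal{C}_{p,e}$ be the category whose objects are the complete discrete valuation rings $R$ of characteristic $0$ with perfect residue field of characteristic $p$ and ramification index $e$ (that is, $pR = \mathfrak{m}^e$, where $\mathfrak{m}$ is the maximal ideal of $R$), and whose morphisms are all ring homomorphisms. For $n \ge 1$ let $\mathcal{R}_{p,e}^n$ be the category whose objects are the principal Artinian local rings $\overline{R}$, with maximal ideal $\overline{\mathfrak{m}}$, of length $n$ (that is, $\overline{\mathfrak{m}}^n = 0$ and $\overline{\mathfrak{m}}^{n-1} \ne 0$), with perfect residue field of characteristic $p$ and, in case $n > e$, with $p \in \overline{\mathfrak{m}}^e \setminus \overline{\mathfrak{m}}^{e+1}$; its morphisms are all ring homomorphisms. Let $\mathrm{Pr}_n : \mathcal{C}_{p,e} \to \mathcal{R}_{p,e}^n$, $R \mapsto R/\mathfrak{m}^n$, and, for $m \ge n$, $\mathrm{Pr}^m_n : \mathcal{R}_{p,e}^m \to \mathcal{R}_{p,e}^n$, $\overline{R} \mapsto \overline{R}/\overline{\mathfrak{m}}^n$, be the canonical projection functors. The category $\mathcal{C}_{p,e}$ is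 called $n$-liftable if there is a functor $L : \mathcal{R}_{p,e}^n \to \mathcal{C}_{p,e}$ (an $n$-th lifting functor) such that - $(\mathrm{Pr}_n \circ L)(\overline{R}) \cong \overline{R}$ for every object $\overline{R}$ of $\mathcal{R}_{p,e}^n$; - the functor $\mathrm{Pr}_1 \circ L$ is naturally isomorphic to $\mathrm{Pr}^n_1$; - the functor $L \circ \mathrm{Pr}_n$ is naturally isomorphic to the identity functor of $\mathcal{C}_{p,e}$. The lifting number for $\mathcal{C}_{p,e}$ is the least integer $n \ge 1$ such that $\mathcal{C}_{p,e}$ is $n$-liftable, and $\infty$ if there is no such $n$. **Theorem.** There is exactly one integer $\nu(e) \ge 0$ such that $eR = \mathfrak{m}^{\nu(e)}$ for every object $R$ of $\mathcal{C}_{p,e}$ with maximal ideal $\mathfrak{m}$; thus $\nu(e)$ depends only on $p$ and $e$, not on $R$. The category $\mathcal{C}_{p,e}$ is $(e + e\,\nu(e) + 1)$-liftable. In particular, the lifting number for $\mathcal{C}_{p,e}$ is finite. -/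

import Mathlib

open CategoryTheory IsLocalRing

universe u

namespace DVRLifting

/-! ### The two families of rings -/

/-- `R` is a complete discrete valuation ring of mixed characteristic `(0, p)` whose residue field
is perfect (of characteristic `p`) and whose absolute ramification index is `e`, that is,
`p R = 𝔪 ^ e`. -/
structure IsCompleteMixedCharDVR (p e : ℕ) (R : Type u) [CommRing R] : Prop
    extends IsDomain R, IsDiscreteValuationRing R where
  isAdicComplete : IsAdicComplete (maximalIdeal R) R
  charZero : CharZero R
  charP_residueField : CharP (ResidueField R) p
  perfectField_residueField : PerfectField (ResidueField R)
  span_natCast : Ideal.span {(p : R)} = maximalIdeal R ^ e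

/-- `R` is a principal Artinian local ring of length `n` (`𝔪 ^ n = 0` and `𝔪 ^ (n - 1) ≠ 0`) with
perfect residue field of characteristic `p`, such that moreover `p ∈ 𝔪 ^ e ∖ 𝔪 ^ (e + 1)` in case
`n > e`. No such ring exists for `n = 0`. -/
structure IsPrincipalArtinianLocal (p e n : ℕ) (R : Type u) [CommRing R] : Prop
    extends IsLocalRing R, IsPrincipalIdealRing R where
  isArtinianRing : IsArtinianRing R
  maximalIdeal_pow : maximalIdeal R ^ n = ⊥
  maximalIdeal_pow_pred : maximalIdeal R ^ (n - 1) ≠ ⊥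
  charP_residueField : CharP (ResidueField R) p
  perfectField_residueField : PerfectField (ResidueField R)
  natCast_mem : e < n → (p : R) ∈ maximalIdeal R ^ e ∧ (p : R) ∉ maximalIdeal R ^ (e + 1)

/-- The category of complete discrete valuation rings of mixed characteristic `(0, p)` with perfect
residue field and absolute ramification index `e`; its morphisms are all ring homomorphisms. -/
abbrev DVRCat (p e : ℕ) : Type (u + 1) :=
  ObjectProperty.FullSubcategory
    (fun R : CommRingCat.{u} => IsCompleteMixedCharDVR p e R)

/-- The category of principal Artinian local rings of length `n` with perfect residue field of
characteristic `p` (and `p ∈ 𝔪 ^ e ∖ 𝔪 ^ (e + 1)` if `n > e`); its morphisms are all ring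
homomorphisms. -/
abbrev ArtCat (p e n : ℕ) : Type (u + 1) :=
  ObjectProperty.FullSubcategory
    (fun R : CommRingCat.{u} => IsPrincipalArtinianLocal p e n R)

instance (p e : ℕ) (R : DVRCat.{u} p e) : IsDomain R.obj := R.property.toIsDomain

instance (p e : ℕ) (R : DVRCat.{u} p e) : IsDiscreteValuationRing R.obj :=
  R.property.toIsDiscreteValuationRing

instance (p e n : ℕ) (R : ArtCat.{u} p e n) : IsLocalRing R.obj := R.property.toIsLocalRing

/-! ### The `n`-th residue ring -/

/-- The `n`-th residue ring `R / 𝔪 ^ n` of a local ring. -/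
abbrev ResidueRing (R : Type u) [CommRing R] [IsLocalRing R] (n : ℕ) : Type u :=
  R ⧸ maximalIdeal R ^ n

theorem maximalIdeal_pow_le_comap {R S : Type u} [CommRing R] [CommRing S] [IsLocalRing R]
    [IsLocalRing S] (f : R →+* S) (hf : maximalIdeal R ≤ (maximalIdeal S).comap f) (n : ℕ) :
    maximalIdeal R ^ n ≤ (maximalIdeal S ^ n).comap f :=
  (Ideal.pow_right_mono hf n).trans (Ideal.le_comap_pow f n)

/-- The homomorphism of `n`-th residue rings induced by a homomorphism of local rings. -/
def residueRingMap {R S : Type u} [CommRing R] [CommRing S] [IsLocalRing R] [IsLocalRing S]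
    (f : R →+* S) (hf : maximalIdeal R ≤ (maximalIdeal S).comap f) (n : ℕ) :
    ResidueRing R n →+* ResidueRing S n :=
  Ideal.quotientMap _ f (maximalIdeal_pow_le_comap f hf n)

theorem perfectField_of_bijective {K L : Type u} [Field K] [Field L] (f : K →+* L)
    (hf : Function.Bijective f) (hK : PerfectField K) : PerfectField L := by
  refine ⟨fun {g} hg => ?_⟩
  let E := RingEquiv.ofBijective f hf
  have h1 : Irreducible ((Polynomial.mapEquiv E.symm) g) :=
    (MulEquiv.irreducible_iff (Polynomial.mapEquiv E.symm)).2 hg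
  have h2 := (hK.separable_of_irreducible h1).map (f := (E : K →+* L))
  have h3 : ((Polynomial.mapEquiv E.symm) g).map (E : K →+* L) = g := by
    change (Polynomial.mapEquiv E) ((Polynomial.mapEquiv E.symm) g) = g
    ext i
    simp
  rwa [h3] at h2

/-- The residue rings of the local rings considered here are principal Artinian local rings. -/
theorem isPrincipalArtinianLocal_residueRing {p e n : ℕ} (R : Type u) [CommRing R]
    [IsLocalRing R] [IsPrincipalIdealRing R] (hchar : CharP (ResidueField R) p)
    (hperf : PerfectField (ResidueField R))
    (hpow : ¬ maximalIdeal R ^ (n - 1) ≤ maximalIdeal R ^ n)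
    (hp : e < n → (p : R) ∈ maximalIdeal R ^ e ∧ (p : R) ∉ maximalIdeal R ^ (e + 1)) :
    IsPrincipalArtinianLocal p e n (ResidueRing R n) := by
  have hne : maximalIdeal R ^ n ≠ ⊤ := fun h => hpow (h ▸ le_top)
  have hnt : Nontrivial (ResidueRing R n) := Ideal.Quotient.nontrivial_iff.2 hne
  have hsurj : Function.Surjective (Ideal.Quotient.mk (maximalIdeal R ^ n)) :=
    Ideal.Quotient.mk_surjective
  have hloc : IsLocalRing (ResidueRing R n) := IsLocalRing.of_surjective' _ hsurj
  have hlh : IsLocalHom (Ideal.Quotient.mk (maximalIdeal R ^ n)) :=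
    IsLocalHom.of_surjective _ hsurj
  have hpir : IsPrincipalIdealRing (ResidueRing R n) :=
    IsPrincipalIdealRing.of_surjective _ hsurj
  have hmap : (maximalIdeal R).map (Ideal.Quotient.mk (maximalIdeal R ^ n)) =
      maximalIdeal (ResidueRing R n) :=
    IsLocalRing.map_maximalIdeal_of_surjective _ hsurj
  have hzero : maximalIdeal (ResidueRing R n) ^ n = ⊥ := by
    rw [← hmap, ← Ideal.map_pow, Ideal.map_quotient_self]
  have hle : ∀ k, k ≤ n → ∀ x : R,
      Ideal.Quotient.mk (maximalIdeal R ^ n) x ∈ maximalIdeal (ResidueRing R n) ^ k ↔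
        x ∈ maximalIdeal R ^ k := by
    intro k hk x
    rw [← hmap, ← Ideal.map_pow, ← Ideal.mem_comap, Ideal.comap_map_of_surjective _ hsurj,
      ← RingHom.ker_eq_comap_bot, Ideal.mk_ker, sup_eq_left.2 (Ideal.pow_le_pow_right hk)]
  have hbij : Function.Bijective
      (ResidueField.map (Ideal.Quotient.mk (maximalIdeal R ^ n))) :=
    ⟨RingHom.injective _, fun y => by
      obtain ⟨y, rfl⟩ := residue_surjective y
      obtain ⟨x, rfl⟩ := hsurj y
      exact ⟨residue R x, rfl⟩⟩
  have hart : IsArtinianRing (ResidueRing R n) :=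
    (isArtinianRing_iff_isNilpotent_maximalIdeal _).2 ⟨n, hzero⟩
  exact
    { toIsLocalRing := hloc
      isArtinianRing := hart
      toIsPrincipalIdealRing := hpir
      maximalIdeal_pow := hzero
      maximalIdeal_pow_pred := by
        intro h
        refine hpow fun x hx => ?_
        have := (hle (n - 1) (Nat.sub_le n 1) x).2 hx
        rw [h, Ideal.mem_bot] at this
        exact Ideal.Quotient.eq_zero_iff_mem.1 this
      charP_residueField := charP_of_injective_ringHom hbij.1 p
      perfectField_residueField := perfectField_of_bijective _ hbij hperf
      natCast_mem := by
        intro h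
        rw [← map_natCast (Ideal.Quotient.mk (maximalIdeal R ^ n)), hle e h.le, hle (e + 1) h]
        exact hp h }

theorem DVRCat.not_pow_le (p e : ℕ) (R : DVRCat.{u} p e) (k : ℕ) :
    ¬ maximalIdeal R.obj ^ k ≤ maximalIdeal R.obj ^ (k + 1) := fun h =>
  absurd (Ideal.pow_right_strictAnti (maximalIdeal R.obj)
    (IsDiscreteValuationRing.not_a_field R.obj) Ideal.IsPrime.ne_top' k.lt_succ_self)
    (not_lt_of_ge h)

theorem DVRCat.residueRing (p e n : ℕ) (hn : 0 < n) (R : DVRCat.{u} p e) :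
    IsPrincipalArtinianLocal p e n (ResidueRing R.obj n) := by
  obtain ⟨n, rfl⟩ := Nat.exists_eq_succ_of_ne_zero hn.ne'
  refine isPrincipalArtinianLocal_residueRing R.obj R.property.charP_residueField
    R.property.perfectField_residueField (DVRCat.not_pow_le p e R n) fun _ => ?_
  have hs : Ideal.span {(p : R.obj)} = maximalIdeal R.obj ^ e := R.property.span_natCast
  refine ⟨hs ▸ Ideal.mem_span_singleton_self _, fun h => DVRCat.not_pow_le p e R e ?_⟩
  rw [← hs]
  exact (Ideal.span_singleton_le_iff_mem _).2 h

theorem ArtCat.residueRing (p e : ℕ) {m n : ℕ} (hn : 0 < n) (hnm : n ≤ m) (R : ArtCat.{u} p e m) :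
    IsPrincipalArtinianLocal p e n (ResidueRing R.obj n) := by
  have := R.property.toIsPrincipalIdealRing
  refine isPrincipalArtinianLocal_residueRing R.obj R.property.charP_residueField
    R.property.perfectField_residueField (fun h => R.property.maximalIdeal_pow_pred ?_)
    fun h => R.property.natCast_mem (h.trans_le hnm)
  rw [eq_bot_iff]
  calc maximalIdeal R.obj ^ (m - 1)
      = maximalIdeal R.obj ^ (m - n) * maximalIdeal R.obj ^ (n - 1) := by
        rw [← pow_add]; congr 1; omega
    _ ≤ maximalIdeal R.obj ^ (m - n) * maximalIdeal R.obj ^ n := Ideal.mul_mono_right h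
    _ = maximalIdeal R.obj ^ m := by rw [← pow_add]; congr 1; omega
    _ ≤ ⊥ := R.property.maximalIdeal_pow.le

/-- Every ring homomorphism in `DVRCat p e` is local. -/
theorem DVRCat.le_comap {p e : ℕ} {R S : DVRCat.{u} p e} (f : R ⟶ S) :
    maximalIdeal R.obj ≤ (maximalIdeal S.obj).comap f.hom.hom := by
  intro x hx
  have hs : Ideal.span {(p : R.obj)} = maximalIdeal R.obj ^ e := R.property.span_natCast
  have hxe : x ^ e ∈ Ideal.span {(p : R.obj)} := hs ▸ Ideal.pow_mem_pow hx e
  obtain ⟨y, hy⟩ := Ideal.mem_span_singleton.1 hxe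
  have hpS : (p : S.obj) ∈ maximalIdeal S.obj := by
    have := S.property.charP_residueField
    rw [← residue_eq_zero_iff, map_natCast, CharP.cast_eq_zero]
  refine Ideal.mem_comap.2 (Ideal.IsPrime.mem_of_pow_mem inferInstance e ?_)
  rw [← map_pow, hy, map_mul, map_natCast]
  exact Ideal.mul_mem_right _ _ hpS

/-- Every ring homomorphism in `ArtCat p e n` is local. -/
theorem ArtCat.le_comap {p e n : ℕ} {R S : ArtCat.{u} p e n} (f : R ⟶ S) :
    maximalIdeal R.obj ≤ (maximalIdeal S.obj).comap f.hom.hom := by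
  intro x hx
  have h0 : x ^ n = 0 := by
    have := Ideal.pow_mem_pow hx n
    rwa [R.property.maximalIdeal_pow, Ideal.mem_bot] at this
  refine Ideal.mem_comap.2 (Ideal.IsPrime.mem_of_pow_mem inferInstance n ?_)
  rw [← map_pow, h0, map_zero]
  exact zero_mem _

/-! ### The projection functors -/

/-- The projection functor `Pr_n`, sending `R` to its `n`-th residue ring (`n ≥ 1`). -/
def Pr (p e n : ℕ) (hn : 0 < n) : DVRCat.{u} p e ⥤ ArtCat.{u} p e n where
  obj R := ⟨CommRingCat.of (ResidueRing R.obj n), DVRCat.residueRing p e n hn R⟩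
  map f := ObjectProperty.homMk
    (CommRingCat.ofHom (residueRingMap f.hom.hom (DVRCat.le_comap f) n))
  map_id R := by
    ext x
    rfl
  map_comp f g := by
    ext x
    rfl

/-- The projection functor `Pr^m_n`, sending `R` to its `n`-th residue ring (`1 ≤ n ≤ m`). -/
def PrArt (p e m n : ℕ) (hn : 0 < n) (hnm : n ≤ m) : ArtCat.{u} p e m ⥤ ArtCat.{u} p e n where
  obj R := ⟨CommRingCat.of (ResidueRing R.obj n), ArtCat.residueRing p e hn hnm R⟩
  map f := ObjectProperty.homMk
    (CommRingCat.ofHom (residueRingMap f.hom.hom (ArtCat.le_comap f) n))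
  map_id R := by
    ext x
    rfl
  map_comp f g := by
    ext x
    rfl

/-! ### Liftability -/

/-- `L` is an `n`-th lifting functor of `DVRCat p e`. -/
structure IsLiftingFunctor (p e n : ℕ) (hn : 0 < n) (L : ArtCat.{u} p e n ⥤ DVRCat.{u} p e) :
    Prop where
  pr_obj : ∀ R : ArtCat.{u} p e n, Nonempty ((Pr p e n hn).obj (L.obj R) ≅ R)
  comp_pr_one : Nonempty (L ⋙ Pr p e 1 one_pos ≅ PrArt p e n 1 one_pos hn)
  pr_comp : Nonempty (Pr p e n hn ⋙ L ≅ 𝟭 (DVRCat.{u} p e))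

/-- The category `DVRCat p e` is `n`-liftable, for a positive integer `n`. -/
def IsLiftable (p e n : ℕ) : Prop :=
  ∃ (hn : 0 < n) (L : ArtCat.{u} p e n ⥤ DVRCat.{u} p e), IsLiftingFunctor p e n hn L

/-- The lifting number for `DVRCat p e`: the least positive integer `n` such that the category is
`n`-liftable, and `∞` if there is none. -/
noncomputable def liftingNumber (p e : ℕ) : ℕ∞ :=
  sInf {N : ℕ∞ | ∃ n : ℕ, IsLiftable.{u} p e n ∧ N = n}

end DVRLifting

/-! Write `e = p ^ s * m` with `p ∤ m`. Since `m` is a unit and `(p) = 𝔪 ^ e`, the exponent is `ν =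
e * s` in every `R`. Put `n = e + e * ν + 1`.

Objects lift because `n > e`: in an Artinian ring `R` of length `n`, a generator `π` of the maximal
ideal satisfies `π ^ e = p * y` with `y` a unit. Perfectness of the residue field `K` gives a map
from `W = WittVector p K` to `R`, and `y` is a polynomial `Q` of degree `< e` in `π`. So `R` is a
quotient of the Eisenstein extension `A = W[X] / (X ^ e - p Q)`, an object of `DVRCat p e`
(`IsPrincipalArtinianLocal.exists_adjoinRoot_surjective`, `isCompleteMixedCharDVR_adjoinRoot`).

Morphisms lift by a Krasner-type argument (`existsUnique_lift`). Given `f : A →+* S / 𝔪 ^ n`, its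
restriction to `W` lifts to `S`. If `x` lifts the image of the root, then the Eisenstein polynomial
`F` has `F(x) ∈ 𝔪 ^ n`, while `F'(x) ∉ 𝔪 ^ (e + ν)`, because the top coefficient of `F'` is `e`
(`derivative_eval₂_notMem`). A rescaled Hensel lemma then gives exactly one root of `F` in `x + 𝔪 ^
(ν + 2)` (`existsUnique_root_sub_mem`).

The resulting homomorphism need not reduce to `f` modulo `𝔪 ^ n`; it is the only one agreeing with
`f` modulo `𝔪 ^ (ν + 2)`. This weaker congruence is stable under composition, so uniqueness yields
functoriality, and also naturality of the isomorphism `L ∘ Pr_n ≅ 𝟭`. It implies agreement on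
residue fields. Compatibility with `Pr_n` itself is obtained, and required, on objects only. -/

namespace DVRLifting

/-! ### Adic completeness -/

section Adic

variable {R : Type*} [CommRing R]

theorem isAdicComplete_of_pow_eq_bot {I : Ideal R} {n : ℕ} (h : I ^ n = ⊥) :
    IsAdicComplete I R where
  haus' x hx := by
    have := hx n
    rwa [h, Submodule.bot_smul, SModEq.bot] at this
  prec' f hf := by
    refine ⟨f n, fun m => ?_⟩
    rcases le_total m n with hmn | hmn
    · exact hf hmn
    · have := hf hmn
      rw [h, Submodule.bot_smul, SModEq.bot] at this
      rw [this]

theorem isAdicComplete_pow {I : Ideal R} [IsAdicComplete I R] {k : ℕ} (hk : k ≠ 0) :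
    IsAdicComplete (I ^ k) R where
  haus' x hx := by
    refine IsHausdorff.haus' (I := I) x fun n => ?_
    refine SModEq.mono ?_ (hx n)
    rw [← pow_mul]
    exact Submodule.smul_mono_left (Ideal.pow_le_pow_right (Nat.le_mul_of_pos_left n
      (Nat.pos_of_ne_zero hk)))
  prec' f hf := by
    obtain ⟨L, hL⟩ := IsPrecomplete.prec' (I := I) (M := R) f (fun {m n} hmn => by
      refine SModEq.mono ?_ (hf hmn)
      rw [← pow_mul]
      exact Submodule.smul_mono_left (Ideal.pow_le_pow_right (Nat.le_mul_of_pos_left m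
        (Nat.pos_of_ne_zero hk))))
    refine ⟨L, fun n => ?_⟩
    have h1 := hL (k * n)
    rw [pow_mul] at h1
    exact (hf (Nat.le_mul_of_pos_left n (Nat.pos_of_ne_zero hk))).trans h1

theorem isAdicComplete_of_pow {I : Ideal R} {k : ℕ} (hk : k ≠ 0) [IsAdicComplete (I ^ k) R] :
    IsAdicComplete I R where
  haus' x hx := by
    refine IsHausdorff.haus' (I := I ^ k) x fun n => ?_
    rw [← pow_mul]
    exact hx _
  prec' f hf := by
    obtain ⟨L, hL⟩ := IsPrecomplete.prec' (I := I ^ k) (M := R) (fun n => f (k * n))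
      (fun {m n} hmn => by
        rw [← pow_mul]
        exact hf (Nat.mul_le_mul_left k hmn))
    refine ⟨L, fun n => ?_⟩
    have hn : n ≤ k * n := Nat.le_mul_of_pos_left n (Nat.pos_of_ne_zero hk)
    refine (hf hn).trans (SModEq.mono ?_ (hL n))
    rw [← pow_mul]
    exact Submodule.smul_mono_left (Ideal.pow_le_pow_right hn)

/-- Present `M` as a quotient of `R ^ k`: completion preserves surjections and commutes with finite
products, so precompleteness passes from `R` to `M`. -/
theorem isPrecomplete_of_finite (I : Ideal R) [IsPrecomplete I R] (M : Type*) [AddCommGroup M]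
    [Module R M] [Module.Finite R M] : IsPrecomplete I M := by
  obtain ⟨k, q, hq⟩ := Module.Finite.exists_fin' R M
  rw [← AdicCompletion.of_surjective_iff]
  intro y
  obtain ⟨x, rfl⟩ := AdicCompletion.map_surjective I hq y
  choose z hz using fun i => AdicCompletion.of_surjective I R
    (AdicCompletion.piEquivFin I k x i)
  refine ⟨q z, ?_⟩
  rw [← AdicCompletion.map_of]
  congr 1
  apply (AdicCompletion.piEquivFin I k).injective
  funext i
  rw [← hz i]
  rfl

end Adic

/-! ### Homomorphisms from Witt vectors over perfect fields -/

section Witt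

variable {p : ℕ} [Fact p.Prime]

/-- Modulo `I ^ n` a homomorphism is determined by its values on Teichmüller elements. These are `p
^ n`-th powers since `K` is perfect, and raising to the power `p ^ n` turns a congruence modulo `I`
into one modulo `I ^ (n + 1)`. -/
theorem wittVector_hom_ext {K : Type*} [CommRing K] [CharP K p] [PerfectRing K p] {O : Type*}
    [CommRing O] (I : Ideal O) [IsHausdorff I O] (hp : (p : O) ∈ I) (f g : WittVector p K →+* O)
    (h : ∀ w, f w - g w ∈ I) : f = g := by
  ext w
  rw [IsHausdorff.eq_iff_smodEq (I := I)]
  intro n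
  rw [smul_eq_mul, Ideal.mul_top]
  suffices hfg : (Ideal.Quotient.mk (I ^ n)).comp f = (Ideal.Quotient.mk (I ^ n)).comp g by
    exact SModEq.idealQuotientMk.2 (RingHom.congr_fun hfg w)
  refine WittVector.eq_of_apply_teichmuller_eq _ _ ⟨n, ?_⟩ fun x => ?_
  · rw [← map_natCast (Ideal.Quotient.mk (I ^ n)), ← map_pow, Ideal.Quotient.eq_zero_iff_mem]
    exact Ideal.pow_mem_pow hp n
  · obtain ⟨y, rfl⟩ : ∃ y : K, y ^ p ^ n = x := by
      obtain ⟨y, hy⟩ := (bijective_iterateFrobenius K p n).2 x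
      exact ⟨y, by rwa [iterateFrobenius_def] at hy⟩
    rw [map_pow, RingHom.comp_apply, RingHom.comp_apply, ← SModEq.idealQuotientMk, map_pow,
      map_pow]
    refine SModEq.mono (Ideal.pow_le_pow_right n.le_succ) ?_
    exact SModEq.pow_pow_add_one hp (SModEq.sub_mem.2 (h _)) n

/-- Used for `O / p → ResidueField O`: a kernel killed by a fixed power of Frobenius becomes
invisible in the perfection. -/
theorem exists_perfection_map_eq {B k : Type*} [CommRing B] [CommRing k] [CharP B p] [CharP k p]
    (q : B →+* k) (hq : Function.Surjective q) {N : ℕ}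
    (hN : ∀ b, q b = 0 → b ^ p ^ N = 0) : Function.Bijective (Perfection.map p q) := by
  have key : ∀ b c, q b = q c → b ^ p ^ N = c ^ p ^ N := fun b c h => by
    rw [← sub_eq_zero, ← sub_pow_char_pow]
    exact hN _ (by rw [map_sub, h, sub_self])
  refine ⟨(injective_iff_map_eq_zero _).2 fun x hx => ?_, fun y => ?_⟩
  · ext i
    have h1 : q (Perfection.coeff B p (i + N) x) = 0 := by
      rw [← Perfection.coeff_map, hx, map_zero]
    rw [map_zero, ← Perfection.coeff_iterate_frobenius x i N, iterate_frobenius, map_pow]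
    exact hN _ h1
  · choose b hb using fun i => hq (Perfection.coeff k p i y)
    have hcompat : ∀ i, (b (i + 1 + N) ^ p ^ N) ^ p = b (i + N) ^ p ^ N := fun i => by
      rw [← pow_mul, mul_comm, pow_mul]
      refine key _ _ ?_
      rw [map_pow, hb, hb, add_right_comm, Perfection.coeff_pow_p']
    -- The chosen preimages `b i` are compatible only modulo the kernel; the `p ^ N`-th powers are
    -- compatible exactly, and the shift of the index by `N` undoes the power.
    let x : Perfection B p := ⟨fun i => b (i + N) ^ p ^ N, hcompat⟩
    have hx : ∀ i, Perfection.coeff B p i x = b (i + N) ^ p ^ N := fun i => rfl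
    refine ⟨x, ?_⟩
    · ext i
      rw [Perfection.coeff_map, hx, map_pow, hb, ← map_pow, ← iterate_frobenius,
        Perfection.coeff_iterate_frobenius]

/-- As `K` is perfect, `φ` factors through the perfection of the residue field, which is that of `O
/ p`, i.e. the tilt of `O`. Fontaine's map `θ` from the Witt vectors of the tilt to `O` then gives
the lift. -/
theorem exists_wittVector_lift {K O : Type u} [Field K] [CharP K p] [PerfectRing K p]
    [CommRing O] [IsLocalRing O] [IsAdicComplete (Ideal.span {(p : O)}) O]
    [CharP (ResidueField O) p] {e : ℕ} (he : maximalIdeal O ^ e ≤ Ideal.span {(p : O)})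
    (φ : K →+* ResidueField O) :
    ∃ θ : WittVector p K →+* O, ∀ w, residue O (θ w) = φ (w.coeff 0) := by
  have hpm : (p : O) ∈ maximalIdeal O := by
    rw [← residue_eq_zero_iff, map_natCast, CharP.cast_eq_zero]
  have : Fact (¬ IsUnit (p : O)) := ⟨(mem_maximalIdeal _).1 hpm⟩
  have hle : Ideal.span {(p : O)} ≤ maximalIdeal O :=
    (Ideal.span_singleton_le_iff_mem _).2 hpm
  let q : ModP O p →+* ResidueField O := Ideal.Quotient.lift _ (residue O)
    fun a ha => (residue_eq_zero_iff a).2 (hle ha)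
  have hqs : Function.Surjective q :=
    Ideal.Quotient.lift_surjective_of_surjective _ _ residue_surjective
  obtain ⟨N, hN⟩ : ∃ N, e ≤ p ^ N := ⟨e, (Nat.lt_pow_self (Fact.out : p.Prime).one_lt).le⟩
  have hbij := exists_perfection_map_eq (p := p) q hqs (N := N) (fun b hb => by
    obtain ⟨b, rfl⟩ := Ideal.Quotient.mk_surjective b
    have hb' : b ∈ maximalIdeal O := (residue_eq_zero_iff b).1 hb
    rw [← map_pow, Ideal.Quotient.eq_zero_iff_mem]
    exact he (Ideal.pow_le_pow_right hN (Ideal.pow_mem_pow hb' _)))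
  let E := RingEquiv.ofBijective _ hbij
  let ψ : K →+* PreTilt O p :=
    E.symm.toRingHom.comp (Perfection.lift p K (ResidueField O) φ)
  have hψ : ∀ a, q (PreTilt.coeff 0 (ψ a)) = φ a := fun a => by
    have h1 : Perfection.map p q (ψ a) = Perfection.lift p K (ResidueField O) φ a :=
      E.apply_symm_apply _
    exact congrArg (Perfection.coeff (ResidueField O) p 0) h1
  refine ⟨(WittVector.fontaineTheta O p).comp (WittVector.map ψ), fun w => ?_⟩
  change q (Ideal.Quotient.mk _ (WittVector.fontaineTheta O p (WittVector.map ψ w))) = _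
  rw [WittVector.mk_fontaineTheta, WittVector.map_coeff, hψ]

end Witt

/-! ### Eisenstein extensions of rings of Witt vectors -/

section Eisenstein

open Polynomial

/-- The polynomial `X ^ e - p Q`; it is an Eisenstein polynomial if `deg Q < e` and `Q(0)` is a
unit. -/
noncomputable def eisensteinPoly {W : Type*} [CommRing W] (p e : ℕ) (Q : W[X]) : W[X] :=
  X ^ e - C (p : W) * Q

section General

variable {W : Type*} [CommRing W] {p e : ℕ} {Q : W[X]}

theorem degree_C_mul_lt (hQ : Q.degree < e) (a : W) : (C a * Q).degree < e := by
  refine lt_of_le_of_lt ?_ hQ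
  rw [← smul_eq_C_mul]
  exact degree_smul_le a Q

theorem eisensteinPoly_monic (hQ : Q.degree < e) : (eisensteinPoly p e Q).Monic := by
  nontriviality W
  refine (monic_X_pow e).sub_of_left ?_
  rw [degree_X_pow]
  exact degree_C_mul_lt hQ _

theorem eisensteinPoly_natDegree [Nontrivial W] (hQ : Q.degree < e) :
    (eisensteinPoly p e Q).natDegree = e := by
  refine natDegree_eq_of_degree_eq_some ?_
  rw [eisensteinPoly, degree_sub_eq_left_of_degree_lt, degree_X_pow]
  rw [degree_X_pow]
  exact degree_C_mul_lt hQ _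

theorem eisensteinPoly_coeff (i : ℕ) :
    (eisensteinPoly p e Q).coeff i = (if i = e then 1 else 0) - p * Q.coeff i := by
  simp [eisensteinPoly, coeff_X_pow]

theorem eval₂_eisensteinPoly {S : Type*} [CommRing S] (f : W →+* S) (x : S) :
    (eisensteinPoly p e Q).eval₂ f x = x ^ e - p * Q.eval₂ f x := by
  simp [eisensteinPoly]

theorem root_pow_eq : AdjoinRoot.root (eisensteinPoly p e Q) ^ e =
    p * AdjoinRoot.mk (eisensteinPoly p e Q) Q := by
  have h := AdjoinRoot.eval₂_root (eisensteinPoly p e Q)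
  rw [eval₂_eisensteinPoly, sub_eq_zero] at h
  rw [h, ← AdjoinRoot.aeval_eq, aeval_def, AdjoinRoot.algebraMap_eq]

theorem mk_eq_of_coeff_zero_add (P : W[X]) :
    ∃ r, AdjoinRoot.mk (eisensteinPoly p e Q) P =
      AdjoinRoot.of _ (P.coeff 0) + AdjoinRoot.root _ * r := by
  refine ⟨AdjoinRoot.mk _ P.divX, ?_⟩
  conv_lhs => rw [← P.X_mul_divX_add]
  rw [map_add, map_mul, AdjoinRoot.mk_X, AdjoinRoot.mk_C, add_comm]

end General

variable {p : ℕ} [hp : Fact p.Prime] {K : Type u} [Field K] [CharP K p]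
  {e : ℕ} {Q : (WittVector p K)[X]}

theorem wittVector_isUnit_iff (w : WittVector p K) : IsUnit w ↔ w.coeff 0 ≠ 0 :=
  ⟨fun h => (h.map (WittVector.constantCoeff (p := p) (R := K))).ne_zero,
    WittVector.isUnit_of_coeff_zero_ne_zero w⟩

/-- The reduction map of an Eisenstein extension. -/
noncomputable def adjoinRootResidue (he : 1 ≤ e) :
    AdjoinRoot (eisensteinPoly p e Q) →+* K :=
  AdjoinRoot.lift (WittVector.constantCoeff (p := p) (R := K)) 0 (by
    rw [eval₂_eisensteinPoly, zero_pow (by omega), CharP.cast_eq_zero, zero_mul, sub_zero])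

theorem adjoinRootResidue_of (he : 1 ≤ e) (w : WittVector p K) :
    adjoinRootResidue (Q := Q) he (AdjoinRoot.of _ w) = w.coeff 0 :=
  AdjoinRoot.lift_of _

theorem adjoinRootResidue_root (he : 1 ≤ e) :
    adjoinRootResidue (Q := Q) he (AdjoinRoot.root _) = 0 :=
  AdjoinRoot.lift_root _

theorem adjoinRootResidue_surjective (he : 1 ≤ e) :
    Function.Surjective (adjoinRootResidue (Q := Q) he) := fun a =>
  ⟨AdjoinRoot.of _ (WittVector.teichmuller p a), by
    rw [adjoinRootResidue_of, WittVector.teichmuller_coeff_zero]⟩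

variable (p K) in
theorem charZero_wittVector : CharZero (WittVector p K) := by
  have hp0 := (WittVector.irreducible p (k := K)).ne_zero
  obtain ⟨q, hq⟩ := CharP.exists (WittVector p K)
  rcases CharP.char_is_prime_or_zero (WittVector p K) q with hqp | rfl
  · have h1 : (q : K) = 0 := by
      rw [← map_natCast (WittVector.constantCoeff (p := p) (R := K)), CharP.cast_eq_zero, map_zero]
    have h2 := (Nat.prime_dvd_prime_iff_eq hp.out hqp).1 ((CharP.cast_eq_zero_iff K p q).1 h1)
    refine absurd ?_ hp0
    have h3 := CharP.cast_eq_zero (WittVector p K) q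
    rwa [← h2] at h3
  · exact CharP.charP_to_charZero _

variable [PerfectRing K p]

theorem eisensteinPoly_prime (he : 1 ≤ e) (hQ : Q.degree < e) (hQ0 : IsUnit (Q.coeff 0)) :
    Prime (eisensteinPoly p e Q) := by
  have hprime : (Ideal.span {(p : WittVector p K)}).IsPrime :=
    (Ideal.span_singleton_prime (WittVector.irreducible p).ne_zero).2
      (WittVector.irreducible p).prime
  refine Irreducible.prime (IsEisensteinAt.irreducible (𝓟 := Ideal.span {(p : WittVector p K)})
    ⟨?_, ?_, ?_⟩ hprime (eisensteinPoly_monic hQ).isPrimitive ?_)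
  · rw [(eisensteinPoly_monic hQ).leadingCoeff]
    exact fun h => hprime.ne_top ((Ideal.eq_top_iff_one _).2 h)
  · intro i hi
    rw [eisensteinPoly_natDegree hQ] at hi
    rw [eisensteinPoly_coeff, if_neg hi.ne, zero_sub, neg_mem_iff]
    exact Ideal.mul_mem_right _ _ (Ideal.mem_span_singleton_self _)
  · rw [eisensteinPoly_coeff, if_neg (by omega), zero_sub, neg_mem_iff,
      Ideal.span_singleton_pow, Ideal.mem_span_singleton, pow_two]
    intro h
    exact (WittVector.irreducible p).not_isUnit (isUnit_of_dvd_unit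
      ((mul_dvd_mul_iff_left (WittVector.irreducible p).ne_zero).1 h) hQ0)
  · rw [eisensteinPoly_natDegree hQ]
    exact he

theorem isDomain_adjoinRoot (he : 1 ≤ e) (hQ : Q.degree < e) (hQ0 : IsUnit (Q.coeff 0)) :
    IsDomain (AdjoinRoot (eisensteinPoly p e Q)) :=
  AdjoinRoot.isDomain_of_prime (eisensteinPoly_prime he hQ hQ0)

/-- Precompleteness comes from finiteness over `W`; separatedness from Krull's intersection theorem
in a domain where `p` is not a unit. -/
theorem isAdicComplete_span_adjoinRoot (he : 1 ≤ e) (hQ : Q.degree < e)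
    (hQ0 : IsUnit (Q.coeff 0)) :
    IsAdicComplete (Ideal.span {(p : AdjoinRoot (eisensteinPoly p e Q))})
      (AdjoinRoot (eisensteinPoly p e Q)) := by
  have := isDomain_adjoinRoot he hQ hQ0
  have := (eisensteinPoly_monic (p := p) hQ).finite_adjoinRoot
  have h1 : IsPrecomplete (Ideal.span {(p : WittVector p K)})
    (AdjoinRoot (eisensteinPoly p e Q)) := isPrecomplete_of_finite _ _
  have h2 : (Ideal.span {(p : WittVector p K)}).map
      (algebraMap _ (AdjoinRoot (eisensteinPoly p e Q))) =
        Ideal.span {(p : AdjoinRoot (eisensteinPoly p e Q))} := by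
    rw [Ideal.map_span, Set.image_singleton, map_natCast]
  have h3 := IsPrecomplete.map_algebraMap_iff (S := AdjoinRoot (eisensteinPoly p e Q)).2 h1
  rw [h2] at h3
  have h4 : IsHausdorff (Ideal.span {(p : AdjoinRoot (eisensteinPoly p e Q))})
      (AdjoinRoot (eisensteinPoly p e Q)) := by
    refine IsHausdorff.of_isDomain _ fun h => ?_
    rw [Ideal.span_singleton_eq_top] at h
    have := h.map (adjoinRootResidue (Q := Q) he)
    rw [map_natCast, CharP.cast_eq_zero] at this
    exact not_isUnit_zero this
  exact { }

/-- The root is in the Jacobson radical because its `e`-th power lies in `(p)`. Hence `Q(root)`,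
congruent to the unit `Q(0)` modulo the root, is a unit, and `p` is a unit times `root ^ e`. The
kernel of reduction, generated by `p` and the root, is therefore generated by the root alone. -/
theorem isUnit_mk_and_ker_eq (he : 1 ≤ e) (hQ : Q.degree < e) (hQ0 : IsUnit (Q.coeff 0)) :
    IsUnit (AdjoinRoot.mk (eisensteinPoly p e Q) Q) ∧
    AdjoinRoot.root (eisensteinPoly p e Q) ∈ Ideal.jacobson ⊥ ∧
    RingHom.ker (adjoinRootResidue (Q := Q) he) = Ideal.span {AdjoinRoot.root _} := by
  have := isAdicComplete_span_adjoinRoot he hQ hQ0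
  have hj : AdjoinRoot.root (eisensteinPoly p e Q) ∈ Ideal.jacobson ⊥ := by
    refine Ideal.isRadical_jacobson _ ⟨e, ?_⟩
    rw [root_pow_eq]
    exact Ideal.mul_mem_right _ _ (IsAdicComplete.le_jacobson_bot _
      (Ideal.mem_span_singleton_self _))
  have hu : IsUnit (AdjoinRoot.mk (eisensteinPoly p e Q) Q) := by
    obtain ⟨r, hr⟩ := mk_eq_of_coeff_zero_add (e := e) (Q := Q) Q
    have hw := hQ0.map (AdjoinRoot.of (eisensteinPoly p e Q))
    obtain ⟨v, hv⟩ := hw.exists_right_inv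
    have h1 := Ideal.mem_jacobson_bot.1 hj (r * v)
    rw [hr]
    convert hw.mul h1 using 1
    linear_combination (-(AdjoinRoot.root (eisensteinPoly p e Q) * r)) * hv
  refine ⟨hu, hj, le_antisymm (fun x hx => ?_) ?_⟩
  · obtain ⟨P, rfl⟩ := AdjoinRoot.mk_surjective x
    obtain ⟨r, hr⟩ := mk_eq_of_coeff_zero_add (e := e) (Q := Q) P
    rw [RingHom.mem_ker, hr, map_add, map_mul, adjoinRootResidue_root, zero_mul, add_zero,
      adjoinRootResidue_of] at hx
    rw [hr]
    refine Ideal.add_mem _ ?_ (Ideal.mul_mem_right _ _ (Ideal.mem_span_singleton_self _))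
    obtain ⟨w, hw⟩ := Ideal.mem_span_singleton.1
      ((WittVector.mem_span_p_iff_coeff_zero_eq_zero _).2 hx)
    rw [hw, map_mul, map_natCast]
    refine Ideal.mul_mem_right _ _ ?_
    rw [← Ideal.mul_unit_mem_iff_mem _ hu, ← root_pow_eq]
    exact Ideal.pow_mem_of_mem _ (Ideal.mem_span_singleton_self _) e he
  · rw [Ideal.span_singleton_le_iff_mem]
    exact adjoinRootResidue_root he

theorem isLocalRing_adjoinRoot (he : 1 ≤ e) (hQ : Q.degree < e) (hQ0 : IsUnit (Q.coeff 0)) :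
    IsLocalRing (AdjoinRoot (eisensteinPoly p e Q)) := by
  obtain ⟨-, hj, hker⟩ := isUnit_mk_and_ker_eq (p := p) he hQ hQ0
  have hmax : (RingHom.ker (adjoinRootResidue (Q := Q) he)).IsMaximal :=
    RingHom.ker_isMaximal_of_surjective _ (adjoinRootResidue_surjective he)
  refine IsLocalRing.of_unique_max_ideal ⟨_, hmax, fun M hM => ?_⟩
  refine (hmax.eq_of_le hM.ne_top ?_).symm
  rw [hker, Ideal.span_singleton_le_iff_mem]
  exact Ideal.mem_sInf.1 hj ⟨bot_le, hM⟩

theorem maximalIdeal_adjoinRoot (he : 1 ≤ e) (hQ : Q.degree < e) (hQ0 : IsUnit (Q.coeff 0))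
    [IsLocalRing (AdjoinRoot (eisensteinPoly p e Q))] :
    maximalIdeal (AdjoinRoot (eisensteinPoly p e Q)) = Ideal.span {AdjoinRoot.root _} := by
  rw [← (isUnit_mk_and_ker_eq (p := p) he hQ hQ0).2.2]
  have := RingHom.ker_isMaximal_of_surjective _ (adjoinRootResidue_surjective (Q := Q) he)
  exact (eq_maximalIdeal this).symm

theorem span_natCast_adjoinRoot (he : 1 ≤ e) (hQ : Q.degree < e) (hQ0 : IsUnit (Q.coeff 0)) :
    Ideal.span {(p : AdjoinRoot (eisensteinPoly p e Q))} = Ideal.span {AdjoinRoot.root _} ^ e := by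
  rw [Ideal.span_singleton_pow, root_pow_eq,
    Ideal.span_singleton_mul_right_unit (isUnit_mk_and_ker_eq (p := p) he hQ hQ0).1]

theorem isCompleteMixedCharDVR_adjoinRoot [PerfectField K] (he : 1 ≤ e) (hQ : Q.degree < e)
    (hQ0 : IsUnit (Q.coeff 0)) :
    IsCompleteMixedCharDVR p e (AdjoinRoot (eisensteinPoly p e Q)) := by
  have hdom := isDomain_adjoinRoot he hQ hQ0
  have hloc := isLocalRing_adjoinRoot he hQ hQ0
  have hmax := maximalIdeal_adjoinRoot he hQ hQ0
  have hspan := span_natCast_adjoinRoot he hQ hQ0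
  rw [← hmax] at hspan
  have hinj : Function.Injective (AdjoinRoot.of (eisensteinPoly p e Q)) :=
    AdjoinRoot.of.injective_of_degree_ne_zero (by
      rw [degree_eq_natDegree (eisensteinPoly_monic hQ).ne_zero, eisensteinPoly_natDegree hQ]
      exact_mod_cast (by omega : e ≠ 0))
  have := charZero_wittVector p K
  have hchar : CharZero (AdjoinRoot (eisensteinPoly p e Q)) :=
    charZero_of_injective_ringHom hinj
  have hnf : ¬ IsField (AdjoinRoot (eisensteinPoly p e Q)) := by
    rw [isField_iff_maximalIdeal_eq]
    intro h
    rw [h, Ideal.bot_pow (by omega), Ideal.span_singleton_eq_bot] at hspan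
    exact hp.out.ne_zero (by exact_mod_cast hspan)
  have hdvr : IsDiscreteValuationRing (AdjoinRoot (eisensteinPoly p e Q)) :=
    ((IsDiscreteValuationRing.TFAE (AdjoinRoot (eisensteinPoly p e Q)) hnf).out 0 4).2
      (show (maximalIdeal _).IsPrincipal from ⟨⟨_, hmax⟩⟩)
  have hlh : IsLocalHom (adjoinRootResidue (Q := Q) he) :=
    IsLocalHom.of_surjective _ (adjoinRootResidue_surjective he)
  have hbij : Function.Bijective (ResidueField.lift (adjoinRootResidue (Q := Q) he)) :=
    ⟨RingHom.injective _, fun a =>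
      (adjoinRootResidue_surjective (Q := Q) he a).imp' (residue _) fun _ h => h⟩
  let E := RingEquiv.ofBijective _ hbij
  exact
    { hdom, hdvr with
      isAdicComplete := by
        have := isAdicComplete_span_adjoinRoot he hQ hQ0
        rw [hspan] at this
        exact isAdicComplete_of_pow (k := e) (by omega)
      charZero := hchar
      charP_residueField := charP_of_injective_ringHom (f := (E.symm : K →+* _)) E.symm.injective p
      perfectField_residueField :=
        perfectField_of_bijective (E.symm : K →+* _) E.symm.bijective inferInstance
      span_natCast := hspan }

end Eisenstein

/-! ### Presentations as quotients of Eisenstein extensions -/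

section Presentation

open Polynomial

variable {p : ℕ} {O : Type u} [CommRing O] [IsLocalRing O]

/-- Expanding digit by digit in `π` reaches every element modulo `π ^ e`, hence modulo `p`.
Polynomials of degree `< e` form a finite, so precomplete, `W`-module, and surjectivity modulo `p`
implies surjectivity. -/
theorem exists_eval₂_eq {W : Type*} [CommRing W] (θ : W →+* O)
    (hθ : ∀ a : O, ∃ w, residue O (θ w) = residue O a) {π : O}
    (hπ : maximalIdeal O = Ideal.span {π}) {e : ℕ} (he : π ^ e ∈ Ideal.span {(p : O)})
    [IsPrecomplete (Ideal.span {(p : W)}) W] [IsHausdorff (Ideal.span {(p : O)}) O] (a : O) :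
    ∃ P : W[X], P.degree < e ∧ P.eval₂ θ π = a := by
  have approx : ∀ (k : ℕ) (a : O), ∃ P : W[X], P.degree < k ∧ π ^ k ∣ a - P.eval₂ θ π := by
    intro k
    induction k with
    | zero => exact fun a => ⟨0, by simp [degree_zero], by simp⟩
    | succ k ih =>
      intro a
      obtain ⟨P, hP, c, hc⟩ := ih a
      obtain ⟨w, hw⟩ := hθ c
      refine ⟨P + C w * X ^ k, ?_, ?_⟩
      · refine (degree_add_le _ _).trans_lt (max_lt (hP.trans ?_) ?_)
        · exact_mod_cast k.lt_succ_self
        · exact (degree_C_mul_X_pow_le k w).trans_lt (by exact_mod_cast k.lt_succ_self)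
      · rw [← sub_eq_zero, ← map_sub, residue_eq_zero_iff, hπ, Ideal.mem_span_singleton] at hw
        obtain ⟨d, hd⟩ := hw
        refine ⟨-d, ?_⟩
        simp only [eval₂_add, eval₂_mul, eval₂_C, eval₂_pow, eval₂_X]
        linear_combination hc - π ^ k * hd
  let _ : Algebra W O := θ.toAlgebra
  have hmap : (Ideal.span {(p : W)}).map (algebraMap W O) = Ideal.span {(p : O)} := by
    rw [Ideal.map_span, Set.image_singleton, map_natCast]
  have hH : IsHausdorff (Ideal.span {(p : W)}) O := by
    rw [← IsHausdorff.map_algebraMap_iff (S := O), hmap]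
    infer_instance
  have hfin : Module.Finite W (degreeLT W e) :=
    Module.Finite.equiv (degreeLTEquiv W e).symm
  have hpre := isPrecomplete_of_finite (Ideal.span {(p : W)}) (degreeLT W e)
  let g : degreeLT W e →ₗ[W] O := (aeval π).toLinearMap ∘ₗ (degreeLT W e).subtype
  have hg : Function.Surjective g := by
    refine surjective_of_mkQ_comp_surjective (I := Ideal.span {(p : W)}) fun y => ?_
    obtain ⟨a, rfl⟩ := Submodule.Quotient.mk_surjective _ y
    obtain ⟨P, hP, hPa⟩ := approx e a
    refine ⟨⟨P, mem_degreeLT.2 hP⟩, ?_⟩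
    refine ((Submodule.Quotient.eq _).2 ?_).symm
    rw [Ideal.smul_top_eq_map, hmap]
    obtain ⟨c, hc⟩ := hPa
    change a - P.eval₂ θ π ∈ Ideal.span {(p : O)}
    rw [hc]
    exact Ideal.mul_mem_right _ _ he
  obtain ⟨P, hP⟩ := hg a
  exact ⟨P, mem_degreeLT.1 P.2, hP⟩

variable [hp : Fact p.Prime]

theorem exists_adjoinRoot_surjective [IsAdicComplete (Ideal.span {(p : O)}) O]
    [CharP (ResidueField O) p] [PerfectField (ResidueField O)] {π y : O}
    (hπ : maximalIdeal O = Ideal.span {π}) (hy : IsUnit y) {e : ℕ}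
    (h : π ^ e = p * y) :
    ∃ Q : (WittVector p (ResidueField O))[X], Q.degree < e ∧ IsUnit (Q.coeff 0) ∧
      ∃ Φ : AdjoinRoot (eisensteinPoly p e Q) →+* O, Function.Surjective Φ := by
  have hmem : π ^ e ∈ Ideal.span {(p : O)} := by
    rw [h]
    exact Ideal.mul_mem_right _ _ (Ideal.mem_span_singleton_self _)
  have hperf : PerfectRing (ResidueField O) p := PerfectField.toPerfectRing p
  obtain ⟨θ, hθ⟩ := exists_wittVector_lift (p := p) (O := O) (e := e) (by
    rwa [hπ, Ideal.span_singleton_pow, Ideal.span_singleton_le_iff_mem])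
    (RingHom.id (ResidueField O))
  have hres : ∀ a : O, ∃ w, residue O (θ w) = residue O a := fun a =>
    ⟨WittVector.teichmuller p (residue O a), by
      rw [hθ, WittVector.teichmuller_coeff_zero, RingHom.id_apply]⟩
  obtain ⟨Q, hQ, hQy⟩ := exists_eval₂_eq (p := p) θ hres hπ hmem y
  refine ⟨Q, hQ, ?_, AdjoinRoot.lift θ π ?_, fun a => ?_⟩
  · rw [wittVector_isUnit_iff, ← RingHom.id_apply ((Q.coeff 0).coeff 0), ← hθ]
    have h1 : residue O y = residue O (θ (Q.coeff 0)) := by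
      have hπ0 : residue O π = 0 := by
        rw [residue_eq_zero_iff, hπ]
        exact Ideal.mem_span_singleton_self _
      -- Modulo `π` only the constant term of `Q` survives, so it inherits invertibility from `y`.
      conv_lhs => rw [← hQy, ← Q.X_mul_divX_add]
      rw [eval₂_add, eval₂_mul, eval₂_X, eval₂_C, map_add, map_mul, hπ0, zero_mul, zero_add]
    rw [← h1]
    exact (hy.map (residue O)).ne_zero
  · rw [eval₂_eisensteinPoly, hQy, h, sub_self]
  · obtain ⟨P, -, hP⟩ := exists_eval₂_eq (p := p) θ hres hπ hmem a
    exact ⟨AdjoinRoot.mk _ P, by rw [AdjoinRoot.lift_mk, hP]⟩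

theorem IsPrincipalArtinianLocal.exists_adjoinRoot_surjective {e n : ℕ} (hen : e < n)
    {R : Type u} [CommRing R] (hR : IsPrincipalArtinianLocal p e n R) :
    ∃ (K : Type u) (_ : Field K) (_ : CharP K p) (_ : PerfectField K)
      (Q : (WittVector p K)[X]), Q.degree < e ∧ IsUnit (Q.coeff 0) ∧
      ∃ Φ : AdjoinRoot (eisensteinPoly p e Q) →+* R, Function.Surjective Φ := by
  have := hR.toIsLocalRing
  have := hR.toIsPrincipalIdealRing
  have := hR.charP_residueField
  have := hR.perfectField_residueField
  obtain ⟨π, hπ⟩ := (IsPrincipalIdealRing.principal (maximalIdeal R)).principal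
  rw [Ideal.submodule_span_eq] at hπ
  obtain ⟨h1, h2⟩ := hR.natCast_mem hen
  rw [hπ, Ideal.span_singleton_pow, Ideal.mem_span_singleton] at h1 h2
  obtain ⟨z, hz⟩ := h1
  -- Otherwise `p = π ^ e * z` would lie in `𝔪 ^ (e + 1)`.
  have hzu : IsUnit z := by
    by_contra hzn
    have hzm : z ∈ maximalIdeal R := hzn
    rw [hπ, Ideal.mem_span_singleton] at hzm
    obtain ⟨w, rfl⟩ := hzm
    exact h2 ⟨w, by rw [hz]; ring⟩
  obtain ⟨y, hy⟩ := hzu.exists_right_inv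
  have hcomp : IsAdicComplete (Ideal.span {(p : R)}) R := by
    refine isAdicComplete_of_pow_eq_bot (n := n) (le_bot_iff.1 ?_)
    rw [← hR.maximalIdeal_pow]
    refine Ideal.pow_right_mono ?_ n
    rw [Ideal.span_singleton_le_iff_mem, ← residue_eq_zero_iff, map_natCast, CharP.cast_eq_zero]
  refine ⟨ResidueField R, inferInstance, inferInstance, inferInstance,
    DVRLifting.exists_adjoinRoot_surjective hπ (y := y) ?_ ?_⟩
  · exact IsUnit.of_mul_eq_one z (by rw [mul_comm, hy])
  · rw [hz, mul_assoc, hy, mul_one]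

end Presentation

/-! ### Root finding -/

section Roots

open Polynomial
open scoped Ring

/-- Hensel's lemma for a polynomial which need not be monic. -/
theorem exists_isRoot_of_isAdicComplete {R : Type*} [CommRing R] (I : Ideal R) [IsAdicComplete I R]
    (f : R[X]) (h₁ : f.eval 0 ∈ I) (h₂ : IsUnit (f.derivative.eval 0)) :
    ∃ a ∈ I, f.IsRoot a := by
  obtain ⟨c, hc0, hc⟩ : ∃ c : ℕ → R, c 0 = 0 ∧
      ∀ n, c (n + 1) = c n - f.eval (c n) * (f.derivative.eval (c n))⁻¹ʳ :=
    ⟨fun n => Nat.recOn n 0 fun _ b => b - f.eval b * (f.derivative.eval b)⁻¹ʳ, rfl, fun n => rfl⟩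
  have hc_mod : ∀ n, c n ∈ I := by
    intro n
    induction n with
    | zero => exact hc0 ▸ zero_mem _
    | succ n ih =>
      rw [hc]
      refine sub_mem ih (I.mul_mem_right _ ?_)
      have := sub_dvd_eval_sub (c n) 0 f
      rw [sub_zero] at this
      rw [← sub_add_cancel (f.eval (c n)) (f.eval 0)]
      exact add_mem (Ideal.mem_of_dvd _ this ih) h₁
  have hf'c : ∀ n, IsUnit (f.derivative.eval (c n)) := by
    intro n
    have := isLocalHom_of_le_jacobson_bot I (IsAdicComplete.le_jacobson_bot I)
    refine IsUnit.of_map (Ideal.Quotient.mk I) _ ?_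
    have h3 : Ideal.Quotient.mk I (f.derivative.eval (c n)) =
        Ideal.Quotient.mk I (f.derivative.eval 0) := by
      rw [Ideal.Quotient.eq]
      refine Ideal.mem_of_dvd _ (sub_dvd_eval_sub (c n) 0 f.derivative) ?_
      rw [sub_zero]
      exact hc_mod n
    rw [h3]
    exact h₂.map _
  -- Newton's iteration converges quadratically; this linear bound is all that the limit needs.
  have hfcI : ∀ n, f.eval (c n) ∈ I ^ (n + 1) := by
    intro n
    induction n with
    | zero =>
      rw [zero_add, pow_one, hc0]
      exact h₁
    | succ n ih =>
      obtain ⟨k, hk⟩ := exists_mul_sq_add_linear_part_eq_eval_add f (c n)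
        (-(f.eval (c n) * (f.derivative.eval (c n))⁻¹ʳ))
      have hinv : f.derivative.eval (c n) * (f.derivative.eval (c n))⁻¹ʳ = 1 :=
        Ring.mul_inverse_cancel _ (hf'c n)
      have heq : f.eval (c (n + 1)) =
          f.eval (c n) ^ 2 * (k * ((f.derivative.eval (c n))⁻¹ʳ) ^ 2) := by
        rw [hc, sub_eq_add_neg, ← hk]
        linear_combination (-f.eval (c n)) * hinv
      rw [heq]
      refine Ideal.mul_mem_right _ _
        (Ideal.pow_le_pow_right (show n + 1 + 1 ≤ (n + 1) * 2 by omega) ?_)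
      rw [pow_mul]
      exact Ideal.pow_mem_pow ih 2
  have aux : ∀ m n, m ≤ n → c m ≡ c n [SMOD (I ^ m • ⊤ : Ideal R)] := by
    intro m n hmn
    rw [smul_eq_mul, Ideal.mul_top]
    induction n, hmn using Nat.le_induction with
    | base => rfl
    | succ n hmn ih =>
      refine ih.trans (SModEq.sub_mem.2 ?_)
      rw [hc, sub_sub_cancel]
      exact Ideal.mul_mem_right _ _ (Ideal.pow_le_pow_right (show m ≤ n + 1 by omega) (hfcI n))
  obtain ⟨a, ha⟩ := IsPrecomplete.prec' c (aux _ _)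
  refine ⟨a, ?_, ?_⟩
  · have := ha 1
    rw [smul_eq_mul, Ideal.mul_top, pow_one, SModEq.sub_mem] at this
    rw [← sub_sub_cancel (c 1) a]
    exact sub_mem (hc_mod 1) this
  · refine IsHausdorff.haus' (I := I) _ fun n => ?_
    have := ha n
    rw [smul_eq_mul, Ideal.mul_top] at this ⊢
    refine (this.symm.eval f).trans ?_
    rw [SModEq.zero]
    exact Ideal.pow_le_pow_right n.le_succ (hfcI n)

variable {S : Type*} [CommRing S] [IsDomain S] [IsDiscreteValuationRing S]

theorem exists_of_notMem_pow {ϖ x : S} (hϖ : maximalIdeal S = Ideal.span {ϖ}) {m : ℕ}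
    (hx : x ∉ maximalIdeal S ^ m) : ∃ d < m, ∃ u : S, IsUnit u ∧ x = ϖ ^ d * u := by
  have hirr := (IsDiscreteValuationRing.irreducible_iff_uniformizer ϖ).2 hϖ
  obtain ⟨d, u, rfl⟩ := IsDiscreteValuationRing.eq_unit_mul_pow_irreducible
    (fun h : x = 0 => hx (h ▸ zero_mem _)) hirr
  refine ⟨d, ?_, u, u.isUnit, mul_comm _ _⟩
  by_contra! hmd
  refine hx (Ideal.pow_le_pow_right hmd (Ideal.mul_mem_left _ _ (Ideal.pow_mem_pow ?_ d)))
  rw [hϖ]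
  exact Ideal.mem_span_singleton_self _

/-- Substitute `z = x + x ^ (ν + 1) * y` and divide by `x ^ (d + ν + 1)`, where `d < e + ν` is the
valuation of `P'(x)`. The quotient `H` has constant term in `𝔪` and unit linear term, so Hensel's
lemma gives one root `y ∈ 𝔪`. -/
theorem existsUnique_root_sub_mem [IsAdicComplete (maximalIdeal S) S] {P : S[X]} {e ν : ℕ}
    (hP : ∀ i, i < e → P.coeff i ∈ maximalIdeal S ^ e) (heν : 2 ≤ e ∨ ν = 0) {x : S}
    (hx : maximalIdeal S = Ideal.span {x}) (h0 : P.eval x ∈ maximalIdeal S ^ (e + e * ν + 1))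
    (h1 : P.derivative.eval x ∉ maximalIdeal S ^ (e + ν)) :
    ∃! z, P.eval z = 0 ∧ z - x ∈ maximalIdeal S ^ (ν + 2) := by
  have hx0 : x ≠ 0 := by
    rintro rfl
    exact IsDiscreteValuationRing.not_a_field S (by simpa using hx)
  have hpow : ∀ k, maximalIdeal S ^ k = Ideal.span {x ^ k} := fun k => by
    rw [hx, Ideal.span_singleton_pow]
  obtain ⟨d, hd, u, hu, hdu⟩ := exists_of_notMem_pow hx h1
  -- In the `j`-th Taylor coefficient, terms from `P.coeff i` with `i < e` are divisible by `x ^ e`,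
  -- and the others carry a factor `x ^ (i - j)` with `i ≥ e`.
  have hcoeff : ∀ j, j ≤ e → x ^ (e - j) ∣ (taylor x P).coeff j := by
    intro j hj
    rw [taylor_coeff, eval_eq_sum_range]
    refine Finset.dvd_sum fun i _ => ?_
    rw [hasseDeriv_coeff]
    rcases lt_or_ge (i + j) e with h | h
    · have h2 := hP _ h
      rw [hpow, Ideal.mem_span_singleton] at h2
      exact ((pow_dvd_pow x (Nat.sub_le e j)).trans h2).mul_left _ |>.mul_right _
    · exact (pow_dvd_pow x (by omega)).mul_left _
  have hG0 : x ^ (d + ν + 2) ∣ (taylor x P).coeff 0 := by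
    rw [taylor_coeff_zero]
    rw [hpow, Ideal.mem_span_singleton] at h0
    refine (pow_dvd_pow x ?_).trans h0
    -- Since `d ≤ e + ν - 1`, the claim reduces to `2 * ν ≤ e * ν`; this is where `heν` enters.
    rcases heν with h | rfl
    · nlinarith
    · omega
  have hG1 : (taylor x P).coeff 1 = x ^ d * u := by rw [taylor_coeff_one, hdu]
  obtain ⟨H, hH⟩ : C (x ^ (d + ν + 1)) ∣ (taylor x P).comp (C (x ^ (ν + 1)) * X) := by
    rw [C_dvd_iff_dvd_coeff]
    intro j
    rw [comp_C_mul_X_coeff]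
    rcases Nat.lt_or_ge j 2 with hj | hj
    · interval_cases j
      · rw [pow_zero, mul_one]
        exact (pow_dvd_pow x (Nat.le_succ _)).trans hG0
      · rw [hG1, pow_one, add_assoc, pow_add]
        exact mul_dvd_mul (dvd_mul_right _ _) dvd_rfl
    · rcases le_or_gt j e with hje | hje
      -- The exponent is `(e - j) + (ν + 1) * j = e + ν * j ≥ e + 2 * ν ≥ d + ν + 1`.
      · have h2 := mul_dvd_mul (hcoeff j hje) (dvd_refl ((x ^ (ν + 1)) ^ j))
        refine dvd_trans ?_ h2
        rw [← pow_mul, ← pow_add]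
        refine pow_dvd_pow x ?_
        have : 2 * ν ≤ ν * j := by nlinarith
        have : (ν + 1) * j = ν * j + j := by ring
        omega
      · refine Dvd.dvd.mul_left ?_ _
        rw [← pow_mul]
        refine pow_dvd_pow x ?_
        have : 2 * ν ≤ ν * j := by nlinarith
        have : (ν + 1) * j = ν * j + j := by ring
        omega
  have hxp : x ^ (d + ν + 1) ≠ 0 := pow_ne_zero _ hx0
  have hHc : ∀ j, x ^ (d + ν + 1) * H.coeff j = (taylor x P).coeff j * (x ^ (ν + 1)) ^ j :=
    fun j => by rw [← coeff_C_mul, ← hH, comp_C_mul_X_coeff]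
  have hHe : ∀ z, x ^ (d + ν + 1) * H.eval z = P.eval (x ^ (ν + 1) * z + x) := fun z => by
    have := congrArg (eval z) hH
    rw [eval_mul, eval_C, eval_comp, taylor_eval, eval_mul, eval_C, eval_X] at this
    exact this.symm
  have hH0 : H.eval 0 ∈ maximalIdeal S := by
    rw [← coeff_zero_eq_eval_zero, hx, Ideal.mem_span_singleton]
    have h2 := hHc 0
    rw [pow_zero, mul_one] at h2
    rw [← h2, pow_succ] at hG0
    exact (mul_dvd_mul_iff_left hxp).1 hG0
  have hH1 : IsUnit (H.derivative.eval 0) := by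
    rw [← coeff_zero_eq_eval_zero, coeff_derivative]
    have h2 := hHc 1
    rw [hG1] at h2
    have h3 : H.coeff 1 = u := mul_left_cancel₀ hxp (by rw [h2]; ring)
    simpa [h3] using hu
  have hroot : ∀ z, P.eval (x ^ (ν + 1) * z + x) = 0 ↔ H.eval z = 0 := fun z => by
    rw [← hHe, mul_eq_zero, or_iff_right hxp]
  obtain ⟨z, hz, hzr⟩ := exists_isRoot_of_isAdicComplete (maximalIdeal S) H hH0 hH1
  refine ⟨x ^ (ν + 1) * z + x, ⟨(hroot z).2 hzr, ?_⟩, ?_⟩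
  · rw [add_sub_cancel_right, pow_succ (maximalIdeal S) (ν + 1)]
    refine Ideal.mul_mem_mul (Ideal.pow_mem_pow ?_ _) hz
    rw [hx]
    exact Ideal.mem_span_singleton_self _
  · rintro w ⟨hw, hwx⟩
    rw [hpow, Ideal.mem_span_singleton] at hwx
    obtain ⟨t, ht⟩ := hwx
    have hwt : w = x ^ (ν + 1) * (x * t) + x := by linear_combination ht
    rw [hwt] at hw ⊢
    have hxt : x * t ∈ maximalIdeal S := by
      rw [hx]
      exact Ideal.mul_mem_right _ _ (Ideal.mem_span_singleton_self _)
    have huz : IsUnit (H.derivative.eval z) := by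
      by_contra h2
      have h3 := Ideal.mem_of_dvd _ (sub_dvd_eval_sub z 0 H.derivative)
        (by rwa [sub_zero] : z - 0 ∈ maximalIdeal S)
      have h4 := sub_mem (show H.derivative.eval z ∈ maximalIdeal S from h2) h3
      rw [sub_sub_cancel] at h4
      exact h4 hH1
    rw [IsLocalRing.eq_of_eval_eq_zero_of_not_isUnit_sub hzr ((hroot _).1 hw)
      (sub_mem hz hxt) huz]

end Roots

/-! ### Polynomials over Witt vectors evaluated at a uniformizer -/

section Indep

open Polynomial

variable {p : ℕ} [hp : Fact p.Prime] {K : Type u} [Field K] [CharP K p] [PerfectRing K p]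
  {S : Type u} [CommRing S] [IsDomain S] [IsDiscreteValuationRing S]

/-- Terms with unit coefficients would have distinct valuations below `e`, so they cannot cancel. In
the induction, lower terms are already divisible by `p`, hence in `𝔪 ^ e`, and higher ones are in `𝔪
^ (i + 1)`, forcing the `i`-th coefficient into `𝔪`. -/
theorem dvd_coeff_of_eval₂_mem (σ : WittVector p K →+* S) {e : ℕ}
    (hpe : Ideal.span {(p : S)} = maximalIdeal S ^ e) {x : S}
    (hx : maximalIdeal S = Ideal.span {x}) {G : (WittVector p K)[X]} (hG : G.degree < e)
    (h : G.eval₂ σ x ∈ maximalIdeal S ^ e) (i : ℕ) : (p : WittVector p K) ∣ G.coeff i := by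
  have hx0 : x ≠ 0 := by
    rintro rfl
    exact IsDiscreteValuationRing.not_a_field S (by simpa using hx)
  have hpow : ∀ k, maximalIdeal S ^ k = Ideal.span {x ^ k} := fun k => by
    rw [hx, Ideal.span_singleton_pow]
  induction i using Nat.strong_induction_on with
  | _ i ih =>
  rcases lt_or_ge i e with hie | hie
  swap
  · rw [coeff_eq_zero_of_degree_lt (hG.trans_le (by exact_mod_cast hie))]
    exact dvd_zero _
  have hdeg : G.natDegree < e := by
    rcases eq_or_ne G 0 with rfl | hG0
    · rw [natDegree_zero]
      omega
    · exact (natDegree_lt_iff_degree_lt hG0).2 hG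
  rw [eval₂_eq_sum_range' σ (n := e) hdeg, ← Finset.add_sum_erase _ _ (Finset.mem_range.2 hie)] at h
  have h2 : ∑ j ∈ (Finset.range e).erase i, σ (G.coeff j) * x ^ j ∈ maximalIdeal S ^ (i + 1) := by
    refine sum_mem fun j hj => ?_
    rcases lt_or_gt_of_ne (Finset.ne_of_mem_erase hj) with hji | hji
    · obtain ⟨w, hw⟩ := ih j hji
      rw [hw, map_mul, map_natCast]
      refine Ideal.mul_mem_right _ _ (Ideal.mul_mem_right _ _ ?_)
      refine Ideal.pow_le_pow_right hie ?_
      rw [← hpe]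
      exact Ideal.mem_span_singleton_self _
    · rw [hpow, Ideal.mem_span_singleton]
      exact (pow_dvd_pow x hji).mul_left _
  have h3 := sub_mem (Ideal.pow_le_pow_right hie h) h2
  rw [add_sub_cancel_right, hpow, Ideal.mem_span_singleton, pow_succ',
    mul_dvd_mul_iff_right (pow_ne_zero _ hx0)] at h3
  rw [← Ideal.mem_span_singleton, WittVector.mem_span_p_iff_coeff_zero_eq_zero]
  by_contra h4
  have h5 := ((wittVector_isUnit_iff _).2 h4).map σ
  have h6 : σ (G.coeff i) ∈ maximalIdeal S := by rwa [hx, Ideal.mem_span_singleton]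
  exact h6 h5

theorem pow_dvd_coeff_of_eval₂_mem (σ : WittVector p K →+* S) {e : ℕ} (hp0 : (p : S) ≠ 0)
    (hpe : Ideal.span {(p : S)} = maximalIdeal S ^ e) {x : S}
    (hx : maximalIdeal S = Ideal.span {x}) (s : ℕ) {G : (WittVector p K)[X]} (hG : G.degree < e)
    (h : G.eval₂ σ x ∈ maximalIdeal S ^ (e * s)) (i : ℕ) :
    (p : WittVector p K) ^ s ∣ G.coeff i := by
  induction s generalizing G with
  | zero => simp
  | succ s ih =>
    obtain ⟨G', rfl⟩ := C_dvd_iff_dvd_coeff _ _ |>.2 (dvd_coeff_of_eval₂_mem σ hpe hx hG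
      (Ideal.pow_le_pow_right (Nat.le_mul_of_pos_right e s.succ_pos) h))
    rw [coeff_C_mul, pow_succ']
    refine mul_dvd_mul_left _ (ih ?_ ?_)
    · rwa [degree_C_mul (WittVector.irreducible p).ne_zero] at hG
    · rw [eval₂_mul, eval₂_C, map_natCast] at h
      rw [pow_mul, ← hpe, Ideal.span_singleton_pow, Ideal.mem_span_singleton] at h ⊢
      rw [pow_succ'] at h
      exact (mul_dvd_mul_iff_left hp0).1 h

/-- Membership in `𝔪 ^ (e * (s + 1))` would make `p ^ (s + 1)` divide every coefficient of the
derivative, including the one of degree `e - 1`, which is `e` itself. -/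
theorem derivative_eval₂_notMem (σ : WittVector p K →+* S) {e s m : ℕ} (he : 1 ≤ e)
    (hp0 : (p : S) ≠ 0) (hpe : Ideal.span {(p : S)} = maximalIdeal S ^ e) {x : S}
    (hx : maximalIdeal S = Ideal.span {x}) (hes : e = p ^ s * m) (hm : ¬ p ∣ m)
    {Q : (WittVector p K)[X]} (hQ : Q.degree < e) :
    (eisensteinPoly p e Q).derivative.eval₂ σ x ∉ maximalIdeal S ^ (e + e * s) := by
  intro h
  have hcoeff : (eisensteinPoly p e Q).derivative.coeff (e - 1) = e := by
    rw [coeff_derivative, Nat.sub_add_cancel he, eisensteinPoly_coeff, if_pos rfl,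
      coeff_eq_zero_of_degree_lt hQ]
    push_cast [Nat.cast_sub he]
    ring
  have hdeg : (eisensteinPoly p e Q).derivative.degree < e := by
    have := degree_derivative_lt (eisensteinPoly_monic (p := p) hQ).ne_zero
    rwa [degree_eq_natDegree (eisensteinPoly_monic (p := p) hQ).ne_zero,
      eisensteinPoly_natDegree hQ] at this
  have h2 := pow_dvd_coeff_of_eval₂_mem σ hp0 hpe hx (s + 1) hdeg
    (by rwa [mul_add, mul_one, add_comm]) (e - 1)
  rw [hcoeff, hes, pow_succ, Nat.cast_mul, Nat.cast_pow,
    mul_dvd_mul_iff_left (pow_ne_zero _ (WittVector.irreducible p).ne_zero),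
    ← Ideal.mem_span_singleton, WittVector.mem_span_p_iff_coeff_zero_eq_zero] at h2
  have h3 : WittVector.constantCoeff (p := p) (R := K) (m : WittVector p K) = 0 := h2
  rw [map_natCast, CharP.cast_eq_zero_iff K p] at h3
  exact hm h3

end Indep

/-! ### Lifting homomorphisms modulo a power of the maximal ideal -/

section Lift

open Polynomial

theorem pow_maximalIdeal_injective (S : Type*) [CommRing S] [IsDomain S]
    [IsDiscreteValuationRing S] : Function.Injective fun n : ℕ => maximalIdeal S ^ n :=
  (Ideal.pow_right_strictAnti (maximalIdeal S) (IsDiscreteValuationRing.not_a_field S)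
    Ideal.IsPrime.ne_top').injective

theorem span_natCast_eq_pow {p e s m : ℕ} (hm : ¬ p ∣ m) (hes : e = p ^ s * m)
    {S : Type u} [CommRing S] [IsLocalRing S] [CharP (ResidueField S) p]
    (hpe : Ideal.span {(p : S)} = maximalIdeal S ^ e) :
    Ideal.span {(e : S)} = maximalIdeal S ^ (e * s) := by
  have hu : IsUnit (m : S) := by
    by_contra h
    have h1 : (m : S) ∈ maximalIdeal S := h
    rw [← residue_eq_zero_iff, map_natCast, CharP.cast_eq_zero_iff _ p] at h1
    exact hm h1
  rw [pow_mul, ← hpe, Ideal.span_singleton_pow]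
  conv_lhs => rw [hes, Nat.cast_mul, Nat.cast_pow, Ideal.span_singleton_mul_right_unit hu]

theorem maximalIdeal_eq_span_of_pow_sub_mem {S : Type*} [CommRing S] [IsDomain S]
    [IsDiscreteValuationRing S] {a x v : S} {e : ℕ} (he : 1 ≤ e)
    (ha : Ideal.span {a} = maximalIdeal S ^ e) (hv : IsUnit v)
    (hx : x ^ e - a * v ∈ maximalIdeal S ^ (e + 1)) :
    maximalIdeal S = Ideal.span {x} := by
  have haS : a ∈ maximalIdeal S ^ e := ha ▸ Ideal.mem_span_singleton_self a
  have hxm : x ∈ maximalIdeal S := by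
    refine Ideal.IsPrime.mem_of_pow_mem inferInstance e ?_
    rw [← sub_add_cancel (x ^ e) (a * v)]
    exact add_mem (Ideal.pow_le_self (by omega) hx)
      (Ideal.mul_mem_right _ _ (Ideal.pow_le_self (by omega) haS))
  obtain ⟨ϖ, hϖ⟩ := IsDiscreteValuationRing.exists_irreducible S
  rw [hϖ.maximalIdeal_eq, Ideal.mem_span_singleton] at hxm
  obtain ⟨t, rfl⟩ := hxm
  by_cases ht : IsUnit t
  · rw [Ideal.span_singleton_mul_right_unit ht, hϖ.maximalIdeal_eq]
  exfalso
  have ht' : t ∈ maximalIdeal S := ht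
  have hϖm : ϖ ∈ maximalIdeal S := hϖ.not_isUnit
  have h1 : (ϖ * t) ^ e ∈ maximalIdeal S ^ (e + 1) := by
    rw [mul_pow]
    refine Ideal.pow_le_pow_right (show e + 1 ≤ e + e by omega) ?_
    rw [pow_add]
    exact Ideal.mul_mem_mul (Ideal.pow_mem_pow hϖm e) (Ideal.pow_mem_pow ht' e)
  have h2 := sub_mem h1 hx
  rw [sub_sub_cancel, Ideal.mul_unit_mem_iff_mem _ hv, ← Ideal.span_singleton_le_iff_mem, ha] at h2
  have h3 := pow_maximalIdeal_injective S (le_antisymm h2 (Ideal.pow_le_pow_right e.le_succ))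
  omega

variable {p : ℕ} [hp : Fact p.Prime] {K : Type u} [Field K] [CharP K p] [PerfectRing K p]

theorem exists_hom_eq_coeff_zero {k : Type*} [CommRing k] [CharP k p]
    (ψ : WittVector p K →+* k) : ∃ φ : K →+* k, ∀ w, φ (w.coeff 0) = ψ w := by
  let E := WittVector.quotientPEquiv (p := p) (k := K)
  have hψ : ∀ a ∈ Ideal.span {(p : WittVector p K)}, ψ a = 0 := fun a ha => by
    obtain ⟨b, rfl⟩ := Ideal.mem_span_singleton.1 ha
    rw [map_mul, map_natCast, CharP.cast_eq_zero, zero_mul]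
  refine ⟨(Ideal.Quotient.lift _ ψ hψ).comp E.symm.toRingHom, fun w => ?_⟩
  have : E.symm (w.coeff 0) = Ideal.Quotient.mk _ w := E.symm_apply_eq.2 rfl
  change Ideal.Quotient.lift _ _ hψ (E.symm (w.coeff 0)) = _
  rw [this, Ideal.Quotient.lift_mk]

/-- Lift the map that `f` induces on residue fields. Its composite with `Ψ` agrees with `f` modulo
the image of `𝔪`, a nilpotent ideal containing `p`, so the two coincide by `wittVector_hom_ext`. -/
theorem exists_wittVector_lift_comp_eq {S T : Type u} [CommRing S] [CommRing T] [IsLocalRing S]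
    [IsAdicComplete (Ideal.span {(p : S)}) S] [CharP (ResidueField S) p] {e n : ℕ}
    (he : maximalIdeal S ^ e ≤ Ideal.span {(p : S)}) (hn : n ≠ 0) (Ψ : S →+* T)
    (hΨ : Function.Surjective Ψ) (hker : RingHom.ker Ψ = maximalIdeal S ^ n)
    (f : WittVector p K →+* T) : ∃ σ : WittVector p K →+* S, Ψ.comp σ = f := by
  let q : T →+* ResidueField S := Ψ.liftOfSurjective hΨ ⟨residue S, by
    rw [hker, ker_residue]
    exact Ideal.pow_le_self hn⟩
  have hq : ∀ a, q (Ψ a) = residue S a := fun a =>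
    Ψ.liftOfRightInverse_comp_apply _ _ _ a
  obtain ⟨φ, hφ⟩ := exists_hom_eq_coeff_zero (q.comp f)
  obtain ⟨σ, hσ⟩ := exists_wittVector_lift he φ
  have hbot : (maximalIdeal S).map Ψ ^ n = ⊥ := by
    rw [← Ideal.map_pow, ← hker, Ideal.map_eq_bot_iff_le_ker]
  have := isAdicComplete_of_pow_eq_bot hbot
  have hpm : (p : S) ∈ maximalIdeal S := by
    rw [← residue_eq_zero_iff, map_natCast, CharP.cast_eq_zero]
  refine ⟨σ, wittVector_hom_ext ((maximalIdeal S).map Ψ) ?_ _ _ fun w => ?_⟩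
  · rw [← map_natCast Ψ]
    exact Ideal.mem_map_of_mem _ hpm
  · obtain ⟨b, hb⟩ := hΨ (f w)
    rw [RingHom.comp_apply, ← hb, ← map_sub]
    refine Ideal.mem_map_of_mem _ ?_
    rw [← residue_eq_zero_iff, map_sub, hσ, hφ, RingHom.comp_apply, ← hb, hq, sub_self]

/-- A homomorphism from an Eisenstein extension `A` to `S ⧸ 𝔪 ^ (e + e ν + 1)` lifts to a unique
homomorphism from `A` to `S`, if lifting is understood modulo `𝔪 ^ (ν + 2)`. -/
theorem existsUnique_lift {e ν : ℕ} (he : 1 ≤ e) {Q : (WittVector p K)[X]} (hQ : Q.degree < e)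
    (hQ0 : IsUnit (Q.coeff 0)) {S T : Type u} [CommRing S] [IsLocalRing S] [CommRing T]
    (hS : IsCompleteMixedCharDVR p e S) (hν : Ideal.span {(e : S)} = maximalIdeal S ^ ν)
    (Ψ : S →+* T) (hΨ : Function.Surjective Ψ)
    (hker : RingHom.ker Ψ = maximalIdeal S ^ (e + e * ν + 1))
    (f : AdjoinRoot (eisensteinPoly p e Q) →+* T) :
    ∃! g : AdjoinRoot (eisensteinPoly p e Q) →+* S,
      ∀ a b, Ψ b = f a → g a - b ∈ maximalIdeal S ^ (ν + 2) := by
  have := hS.toIsDomain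
  have := hS.toIsDiscreteValuationRing
  have := hS.isAdicComplete
  have := hS.charZero
  have := hS.charP_residueField
  have hpe := hS.span_natCast
  have hp0 : (p : S) ≠ 0 := Nat.cast_ne_zero.2 hp.out.ne_zero
  have hpc : IsAdicComplete (Ideal.span {(p : S)}) S := by
    rw [hpe]
    exact isAdicComplete_pow (by omega)
  have hpS : (p : S) ∈ maximalIdeal S ^ e := hpe ▸ Ideal.mem_span_singleton_self _
  obtain ⟨s, m, hm, hes⟩ := Nat.exists_eq_pow_mul_and_not_dvd (n := e) (by omega) p hp.out.ne_one
  obtain rfl : ν = e * s :=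
    pow_maximalIdeal_injective S (hν.symm.trans (span_natCast_eq_pow hm hes hpe))
  -- For `e = 1` one has `p ^ s = 1`, so `s = 0`.
  have heν : 2 ≤ e ∨ e * s = 0 := by
    rcases Nat.lt_or_ge e 2 with h | h
    · refine Or.inr ?_
      have h1 : p ^ s = 1 := Nat.dvd_one.1 ⟨m, by omega⟩
      rw [(Nat.pow_eq_one.1 h1).resolve_left hp.out.ne_one, mul_zero]
    · exact Or.inl h
  have hle : e * s + 2 ≤ e + e * (e * s) + 1 := by
    have := Nat.le_mul_of_pos_left (e * s) he
    omega
  obtain ⟨σ, hσ⟩ := exists_wittVector_lift_comp_eq hpe.ge (Nat.succ_ne_zero _) Ψ hΨ hker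
    (f.comp (AdjoinRoot.of _))
  obtain ⟨x, hx⟩ := hΨ (f (AdjoinRoot.root _))
  have hΨP : ∀ P, Ψ (P.eval₂ σ x) = f (AdjoinRoot.mk _ P) := fun P => by
    rw [hom_eval₂, hσ, hx, ← hom_eval₂, ← AdjoinRoot.algebraMap_eq, ← aeval_def,
      AdjoinRoot.aeval_eq]
  have hFx : (eisensteinPoly p e Q).eval₂ σ x ∈ maximalIdeal S ^ (e + e * (e * s) + 1) := by
    rw [← hker, RingHom.mem_ker, hΨP, AdjoinRoot.mk_self, map_zero]
  -- `F(x) ≡ 0` says that `x ^ e` is `p` times a unit modulo `𝔪 ^ (e + 1)`, so `x` has valuation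
  -- one.
  have hxspan : maximalIdeal S = Ideal.span {x} := by
    have hFx' := hFx
    rw [eval₂_eisensteinPoly] at hFx'
    have hFx'' := Ideal.pow_le_pow_right (show e + 1 ≤ _ by omega) hFx'
    have hxm : x ∈ maximalIdeal S := by
      refine Ideal.IsPrime.mem_of_pow_mem inferInstance e ?_
      rw [← sub_add_cancel (x ^ e) (p * Q.eval₂ σ x)]
      exact add_mem (Ideal.pow_le_self (by omega) hFx')
        (Ideal.mul_mem_right _ _ (Ideal.pow_le_self (by omega) hpS))
    refine maximalIdeal_eq_span_of_pow_sub_mem he hpe (v := Q.eval₂ σ x) ?_ hFx''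
    rw [← Q.X_mul_divX_add, eval₂_add, eval₂_mul, eval₂_X, eval₂_C]
    by_contra h
    have h1 := sub_mem (show _ ∈ maximalIdeal S from h) (Ideal.mul_mem_right
      (Q.divX.eval₂ σ x) _ hxm)
    rw [add_sub_cancel_left] at h1
    exact h1 (hQ0.map σ)
  obtain ⟨z, ⟨hz, hzx⟩, huniq⟩ := existsUnique_root_sub_mem
    (P := (eisensteinPoly p e Q).map σ) (fun i hi => by
      rw [coeff_map, eisensteinPoly_coeff, if_neg hi.ne, zero_sub, map_neg, map_mul, map_natCast,
        neg_mem_iff]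
      exact Ideal.mul_mem_right _ _ hpS) heν hxspan (by rwa [Polynomial.eval_map]) (by
      rw [derivative_map, Polynomial.eval_map]
      exact derivative_eval₂_notMem σ he hp0 hpe hxspan hes hm hQ)
  rw [Polynomial.eval_map] at hz
  refine ⟨AdjoinRoot.lift σ z hz, fun a b hab => ?_, fun g hg => ?_⟩
  · obtain ⟨P, rfl⟩ := AdjoinRoot.mk_surjective a
    have h1 : P.eval₂ σ x - b ∈ maximalIdeal S ^ (e * s + 2) := by
      refine Ideal.pow_le_pow_right hle ?_
      rw [← hker, RingHom.mem_ker, map_sub, hΨP, hab, sub_self]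
    rw [AdjoinRoot.lift_mk, ← sub_add_sub_cancel _ (P.eval₂ σ x)]
    refine add_mem ?_ h1
    rw [← Polynomial.eval_map, ← Polynomial.eval_map]
    exact Ideal.mem_of_dvd _ (sub_dvd_eval_sub z x _) hzx
  -- Agreement modulo `𝔪` already fixes `g` on Witt vectors; the finer congruence is needed only to
  -- single out the root.
  · have hgσ : g.comp (AdjoinRoot.of _) = σ := by
      refine wittVector_hom_ext (maximalIdeal S) (Ideal.pow_le_self (by omega) hpS) _ _ fun w => ?_
      exact Ideal.pow_le_self (Nat.succ_ne_zero _) (hg _ _ (RingHom.congr_fun hσ w))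
    refine AdjoinRoot.ringHom_ext ?_ ?_
    · rw [hgσ, AdjoinRoot.lift_comp_of]
    · rw [AdjoinRoot.lift_root]
      refine huniq _ ⟨?_, hg _ _ hx⟩
      rw [Polynomial.eval_map, ← hgσ, ← hom_eval₂, AdjoinRoot.eval₂_root, map_zero]

end Lift

/-! ### Homomorphisms between complete discrete valuation rings and Artinian quotients -/

section Rings

variable {p e : ℕ}

theorem maximalIdeal_le_comap_of_surjective {A R : Type*} [CommRing A] [CommRing R] [IsLocalRing A]
    [IsLocalRing R] {Φ : A →+* R} (hΦ : Function.Surjective Φ) :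
    maximalIdeal A ≤ (maximalIdeal R).comap Φ := fun a ha h => by
  have := IsLocalHom.of_surjective Φ hΦ
  exact ha (isUnit_of_map_unit Φ a h)

theorem residueRingMap_one_bijective {A R : Type u} [CommRing A] [CommRing R] [IsLocalRing A]
    [IsLocalRing R] {Φ : A →+* R} (hΦ : Function.Surjective Φ) :
    Function.Bijective (residueRingMap Φ (maximalIdeal_le_comap_of_surjective hΦ) 1) := by
  refine ⟨(injective_iff_map_eq_zero _).2 fun x hx => ?_, fun y => ?_⟩
  · obtain ⟨a, rfl⟩ := Ideal.Quotient.mk_surjective x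
    change Ideal.Quotient.mk _ (Φ a) = 0 at hx
    rw [Ideal.Quotient.eq_zero_iff_mem, pow_one] at hx ⊢
    exact fun h => hx (h.map Φ)
  · obtain ⟨r, rfl⟩ := Ideal.Quotient.mk_surjective y
    obtain ⟨a, rfl⟩ := hΦ r
    exact ⟨Ideal.Quotient.mk _ a, rfl⟩

theorem ker_eq_maximalIdeal_pow {n : ℕ} {A R : Type u} [CommRing A] [IsDomain A]
    [IsDiscreteValuationRing A] [CommRing R] (hR : IsPrincipalArtinianLocal p e n R) {Φ : A →+* R}
    (hΦ : Function.Surjective Φ) : RingHom.ker Φ = maximalIdeal A ^ n := by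
  have := hR.toIsLocalRing
  have hmap : (maximalIdeal A).map Φ = maximalIdeal R :=
    IsLocalRing.map_maximalIdeal_of_surjective Φ hΦ
  have hle : ∀ k, maximalIdeal A ^ k ≤ RingHom.ker Φ ↔ maximalIdeal R ^ k = ⊥ := fun k => by
    rw [← Ideal.map_eq_bot_iff_le_ker, Ideal.map_pow, hmap]
  have hn := (hle n).2 hR.maximalIdeal_pow
  have hne : RingHom.ker Φ ≠ ⊥ := fun h =>
    pow_ne_zero n (IsDiscreteValuationRing.not_a_field A) (le_bot_iff.1 (h ▸ hn))
  obtain ⟨k, hk⟩ := exists_maximalIdeal_pow_eq_of_principal A inferInstance _ hne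
  refine le_antisymm ?_ hn
  rw [hk]
  refine Ideal.pow_le_pow_right ?_
  by_contra! hkn
  refine hR.maximalIdeal_pow_pred ((hle _).1 ?_)
  rw [hk]
  exact Ideal.pow_le_pow_right (by omega)

/-- Both rings have ramification index `e`, so `(𝔪_A R) ^ e = (p) = 𝔪_R ^ e` and `𝔪_A` generates
`𝔪_R`. Surjectivity on residue fields then lifts by completeness, and a nonzero kernel would contain
a power of `𝔪_A`, making a power of `𝔪_R` zero. -/
theorem IsCompleteMixedCharDVR.bijective_of_residue {A R : Type u} [CommRing A] [CommRing R]
    [IsLocalRing R] (he : 1 ≤ e) (hp : p ≠ 0) (hA : IsCompleteMixedCharDVR p e A)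
    (hR : IsCompleteMixedCharDVR p e R) (g : A →+* R)
    (hg : ∀ r, ∃ a, g a - r ∈ maximalIdeal R) : Function.Bijective g := by
  have := hA.toIsDomain
  have := hA.toIsDiscreteValuationRing
  have := hR.toIsDomain
  have := hR.toIsDiscreteValuationRing
  have := hR.charZero
  have := hA.isAdicComplete
  have := hR.isAdicComplete
  have hp0 : (p : R) ≠ 0 := Nat.cast_ne_zero.2 hp
  have hmap : (maximalIdeal A).map g = maximalIdeal R := by
    have h1 : (maximalIdeal A).map g ^ e = maximalIdeal R ^ e := by
      rw [← Ideal.map_pow, ← hA.span_natCast, ← hR.span_natCast, Ideal.map_span,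
        Set.image_singleton, map_natCast]
    have hne : (maximalIdeal A).map g ≠ ⊥ := fun h => by
      rw [h, Ideal.bot_pow (by omega)] at h1
      exact pow_ne_zero e (IsDiscreteValuationRing.not_a_field R) h1.symm
    obtain ⟨k, hk⟩ := exists_maximalIdeal_pow_eq_of_principal R inferInstance _ hne
    rw [hk, ← pow_mul] at h1
    have h2 := pow_maximalIdeal_injective R h1
    rw [hk, show k = 1 by nlinarith, pow_one]
  refine ⟨?_, ?_⟩
  · rw [RingHom.injective_iff_ker_eq_bot]
    by_contra hne
    obtain ⟨k, hk⟩ := exists_maximalIdeal_pow_eq_of_principal A inferInstance _ hne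
    have h1 : maximalIdeal A ^ k ≤ RingHom.ker g := hk.ge
    rw [← Ideal.map_eq_bot_iff_le_ker, Ideal.map_pow, hmap] at h1
    exact pow_ne_zero k (IsDiscreteValuationRing.not_a_field R) h1
  · have : IsHausdorff ((maximalIdeal A).map g) R := by
      rw [hmap]
      infer_instance
    refine surjective_of_mk_map_comp_surjective g (I := maximalIdeal A) fun y => ?_
    obtain ⟨r, rfl⟩ := Ideal.Quotient.mk_surjective y
    obtain ⟨a, ha⟩ := hg r
    exact ⟨a, Ideal.Quotient.eq.2 (hmap.symm ▸ ha)⟩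

end Rings

/-! ### The lifting functor -/

/-- A choice of objects `A` of `DVRCat p e` covering the objects of `ArtCat p e (e + e ν + 1)`,
such that homomorphisms out of the rings `A` lift uniquely modulo `𝔪 ^ (ν + 2)`. -/
structure LiftingData (p e ν : ℕ) where
  obj : ArtCat.{u} p e (e + e * ν + 1) → DVRCat.{u} p e
  proj : ∀ R, (obj R).obj →+* R.obj
  proj_surjective : ∀ R, Function.Surjective (proj R)
  ker_proj : ∀ R, RingHom.ker (proj R) = maximalIdeal (obj R).obj ^ (e + e * ν + 1)
  existsUnique_lift : ∀ (R) (S : DVRCat.{u} p e) (T : Type u) [CommRing T] (Ψ : S.obj →+* T),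
    Function.Surjective Ψ → RingHom.ker Ψ = maximalIdeal S.obj ^ (e + e * ν + 1) →
    ∀ f : (obj R).obj →+* T, ∃! g : (obj R).obj →+* S.obj,
      ∀ a b, Ψ b = f a → g a - b ∈ maximalIdeal S.obj ^ (ν + 2)

theorem nonempty_liftingData {p e ν : ℕ} (hp : p.Prime) (he : 1 ≤ e)
    (hν : ∀ R : DVRCat.{u} p e, Ideal.span {(e : R.obj)} = maximalIdeal R.obj ^ ν) :
    Nonempty (LiftingData.{u} p e ν) := by
  have : Fact p.Prime := ⟨hp⟩
  have h : ∀ R : ArtCat.{u} p e (e + e * ν + 1), ∃ (A : DVRCat.{u} p e) (Φ : A.obj →+* R.obj),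
      Function.Surjective Φ ∧ ∀ (S : DVRCat.{u} p e) (T : Type u) [CommRing T] (Ψ : S.obj →+* T),
        Function.Surjective Ψ → RingHom.ker Ψ = maximalIdeal S.obj ^ (e + e * ν + 1) →
        ∀ f : A.obj →+* T, ∃! g : A.obj →+* S.obj,
          ∀ a b, Ψ b = f a → g a - b ∈ maximalIdeal S.obj ^ (ν + 2) := fun R => by
    obtain ⟨K, _, _, _, Q, hQ, hQ0, Φ, hΦ⟩ :=
      R.property.exists_adjoinRoot_surjective (p := p) (by omega)
    have hperf : PerfectRing K p := PerfectField.toPerfectRing p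
    exact ⟨⟨CommRingCat.of (AdjoinRoot (eisensteinPoly p e Q)),
      isCompleteMixedCharDVR_adjoinRoot he hQ hQ0⟩, Φ, hΦ, fun S T _ Ψ hΨ hker f =>
        existsUnique_lift he hQ hQ0 S.property (hν S) Ψ hΨ hker f⟩
  choose A Φ hΦ hlift using h
  exact ⟨⟨A, Φ, hΦ, fun R => ker_eq_maximalIdeal_pow R.property (hΦ R), hlift⟩⟩

namespace LiftingData

variable {p e ν : ℕ} (D : LiftingData.{u} p e ν)

/-- The lift of a homomorphism of Artinian rings. -/
noncomputable def mapHom {R S : ArtCat.{u} p e (e + e * ν + 1)} (f : R ⟶ S) :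
    (D.obj R).obj →+* (D.obj S).obj :=
  (D.existsUnique_lift R (D.obj S) S.obj (D.proj S) (D.proj_surjective S) (D.ker_proj S)
    (f.hom.hom.comp (D.proj R))).choose

theorem mapHom_sub_mem {R S : ArtCat.{u} p e (e + e * ν + 1)} (f : R ⟶ S) (a : (D.obj R).obj)
    (b : (D.obj S).obj) (h : D.proj S b = f.hom.hom (D.proj R a)) :
    D.mapHom f a - b ∈ maximalIdeal (D.obj S).obj ^ (ν + 2) :=
  (D.existsUnique_lift R (D.obj S) S.obj (D.proj S) (D.proj_surjective S) (D.ker_proj S)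
    (f.hom.hom.comp (D.proj R))).choose_spec.1 a b h

theorem eq_mapHom {R S : ArtCat.{u} p e (e + e * ν + 1)} (f : R ⟶ S)
    (g : (D.obj R).obj →+* (D.obj S).obj)
    (h : ∀ a b, D.proj S b = f.hom.hom (D.proj R a) →
      g a - b ∈ maximalIdeal (D.obj S).obj ^ (ν + 2)) : D.mapHom f = g :=
  ((D.existsUnique_lift R (D.obj S) S.obj (D.proj S) (D.proj_surjective S) (D.ker_proj S)
    (f.hom.hom.comp (D.proj R))).choose_spec.2 g h).symm

theorem map_sub_mem {A B : DVRCat.{u} p e} (g : A.obj →+* B.obj) {a b : A.obj} {k : ℕ}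
    (h : a - b ∈ maximalIdeal A.obj ^ k) : g a - g b ∈ maximalIdeal B.obj ^ k := by
  rw [← map_sub]
  exact maximalIdeal_pow_le_comap g
    (DVRCat.le_comap (ObjectProperty.homMk (CommRingCat.ofHom g) : A ⟶ B)) k h

theorem mapHom_id (he : 1 ≤ e) (R : ArtCat.{u} p e (e + e * ν + 1)) :
    D.mapHom (𝟙 R) = RingHom.id _ := by
  refine D.eq_mapHom _ _ fun a b h => ?_
  -- Two preimages under `proj` differ by an element of `𝔪 ^ (e + e * ν + 1)`, which is inside the
  -- tolerance `𝔪 ^ (ν + 2)`.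
  have hle : ν + 2 ≤ e + e * ν + 1 := by
    have := Nat.le_mul_of_pos_left ν he
    omega
  refine Ideal.pow_le_pow_right hle ?_
  rw [← D.ker_proj, RingHom.mem_ker, map_sub, h, sub_eq_zero]
  rfl

theorem mapHom_comp {R S T : ArtCat.{u} p e (e + e * ν + 1)} (f : R ⟶ S) (g : S ⟶ T) :
    D.mapHom (f ≫ g) = (D.mapHom g).comp (D.mapHom f) := by
  refine D.eq_mapHom _ _ fun a c h => ?_
  obtain ⟨b, hb⟩ := D.proj_surjective S (f.hom.hom (D.proj R a))
  have h1 := D.mapHom_sub_mem g b c (by rw [h, hb]; rfl)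
  have h2 := map_sub_mem (D.mapHom g) (D.mapHom_sub_mem f a b hb)
  rw [RingHom.comp_apply, ← sub_add_sub_cancel _ (D.mapHom g b)]
  exact add_mem h2 h1

/-- The lifting functor. -/
noncomputable def functor (he : 1 ≤ e) : ArtCat.{u} p e (e + e * ν + 1) ⥤ DVRCat.{u} p e where
  obj := D.obj
  map f := ObjectProperty.homMk (CommRingCat.ofHom (D.mapHom f))
  map_id R := by
    rw [D.mapHom_id he]
    rfl
  map_comp f g := by
    rw [D.mapHom_comp]
    rfl

/-- The isomorphism between `Pr_n (L R)` and `R`. -/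
noncomputable def prObjIso (he : 1 ≤ e) (R : ArtCat.{u} p e (e + e * ν + 1)) :
    (Pr p e (e + e * ν + 1) (Nat.succ_pos _)).obj ((D.functor he).obj R) ≅ R :=
  ObjectProperty.isoMk _ (RingEquiv.toCommRingCatIso
    ((Ideal.quotEquivOfEq (D.ker_proj R).symm).trans
      (RingHom.quotientKerEquivOfSurjective (D.proj_surjective R))))

/-- The natural isomorphism between `Pr_1 ∘ L` and the reduction of Artinian rings to their
residue fields. -/
noncomputable def compPrOneIso (he : 1 ≤ e) :
    D.functor he ⋙ Pr p e 1 one_pos ≅ PrArt p e (e + e * ν + 1) 1 one_pos (Nat.le_add_left _ _) :=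
  NatIso.ofComponents
    (fun R => ObjectProperty.isoMk _ (RingEquiv.toCommRingCatIso (RingEquiv.ofBijective _
      (residueRingMap_one_bijective (D.proj_surjective R)))))
    (fun {R S} f => by
      ext x
      obtain ⟨a, rfl⟩ := Ideal.Quotient.mk_surjective x
      obtain ⟨b, hb⟩ := D.proj_surjective S (f.hom.hom (D.proj R a))
      change Ideal.Quotient.mk _ (D.proj S (D.mapHom f a)) =
        Ideal.Quotient.mk _ (f.hom.hom (D.proj R a))
      rw [← hb, Ideal.Quotient.eq, ← map_sub, pow_one]
      exact maximalIdeal_le_comap_of_surjective (D.proj_surjective S)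
        (Ideal.pow_le_self (Nat.succ_ne_zero _) (D.mapHom_sub_mem f a b hb)))

/-- Component at `R` of the isomorphism `L ∘ Pr_n ≅ 𝟭`: the lift to `R` of the projection onto its
own residue ring. -/
theorem exists_counit (R : DVRCat.{u} p e) :
    ∃ g : (D.obj ((Pr p e (e + e * ν + 1) (Nat.succ_pos _)).obj R)).obj →+* R.obj,
      ∀ a b, Ideal.Quotient.mk (maximalIdeal R.obj ^ (e + e * ν + 1)) b = D.proj _ a →
        g a - b ∈ maximalIdeal R.obj ^ (ν + 2) :=
  (D.existsUnique_lift ((Pr p e (e + e * ν + 1) (Nat.succ_pos _)).obj R) R _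
    (Ideal.Quotient.mk (maximalIdeal R.obj ^ (e + e * ν + 1))) Ideal.Quotient.mk_surjective
    Ideal.mk_ker (D.proj _)).exists

theorem nonempty_prCompIso (hp : p ≠ 0) (he : 1 ≤ e) :
    Nonempty (Pr p e (e + e * ν + 1) (Nat.succ_pos _) ⋙ D.functor he ≅ 𝟭 (DVRCat.{u} p e)) := by
  choose ρ hρ using D.exists_counit
  have hbij : ∀ R, Function.Bijective (ρ R) := fun R =>
    (D.obj _).property.bijective_of_residue he hp R.property (ρ R) fun r => by
      obtain ⟨a, ha⟩ := D.proj_surjective ((Pr p e (e + e * ν + 1) (Nat.succ_pos _)).obj R)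
        (Ideal.Quotient.mk _ r)
      exact ⟨a, Ideal.pow_le_self (Nat.succ_ne_zero _) (hρ R a r ha.symm)⟩
  refine ⟨NatIso.ofComponents (fun R => ObjectProperty.isoMk _ (RingEquiv.toCommRingCatIso
    (RingEquiv.ofBijective _ (hbij R)))) fun {R S} t => ?_⟩
  -- Naturality: both composites lift the same homomorphism to `S / 𝔪 ^ n`, so uniqueness identifies
  -- them.
  have key : (ρ S).comp (D.mapHom ((Pr p e (e + e * ν + 1) (Nat.succ_pos _)).map t)) =
      t.hom.hom.comp (ρ R) := by
    refine (D.existsUnique_lift ((Pr p e (e + e * ν + 1) (Nat.succ_pos _)).obj R) S _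
      (Ideal.Quotient.mk (maximalIdeal S.obj ^ (e + e * ν + 1))) Ideal.Quotient.mk_surjective
      Ideal.mk_ker (((Pr p e (e + e * ν + 1) (Nat.succ_pos _)).map t).hom.hom.comp
        (D.proj _))).unique (fun a b hab => ?_) (fun a b hab => ?_)
    · obtain ⟨c, hc⟩ := D.proj_surjective ((Pr p e (e + e * ν + 1) (Nat.succ_pos _)).obj S)
        (Ideal.Quotient.mk _ b)
      have h1 := hρ S c b hc.symm
      have h2 := map_sub_mem (ρ S) (D.mapHom_sub_mem
        ((Pr p e (e + e * ν + 1) (Nat.succ_pos _)).map t) a c (hc.trans hab))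
      rw [RingHom.comp_apply, ← sub_add_sub_cancel _ (ρ S c)]
      exact add_mem h2 h1
    · obtain ⟨r, hr⟩ := Ideal.Quotient.mk_surjective (D.proj _ a)
      have h1 := map_sub_mem t.hom.hom (hρ R a r hr)
      rw [RingHom.comp_apply, ← sub_add_sub_cancel _ (t.hom.hom r)]
      refine add_mem h1 (Ideal.pow_le_pow_right (show ν + 2 ≤ e + e * ν + 1 from ?_) ?_)
      · have := Nat.le_mul_of_pos_left ν he
        omega
      · rw [← Ideal.Quotient.eq, hab]
        exact congrArg ((Pr p e (e + e * ν + 1) (Nat.succ_pos _)).map t).hom.hom hr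
  ext x
  exact RingHom.congr_fun key x

end LiftingData

theorem isLiftable_of_span_eq {p e ν : ℕ} (hp : p.Prime) (he : 1 ≤ e)
    (hν : ∀ R : DVRCat.{u} p e, Ideal.span {(e : R.obj)} = maximalIdeal R.obj ^ ν) :
    IsLiftable.{u} p e (e + e * ν + 1) := by
  obtain ⟨D⟩ := nonempty_liftingData hp he hν
  exact ⟨Nat.succ_pos _, D.functor he, fun R => ⟨D.prObjIso he R⟩, ⟨D.compPrOneIso he⟩,
    D.nonempty_prCompIso hp.ne_zero he⟩

open Polynomial in
-- An object is needed for the uniqueness of `ν`, which would fail over an empty category. The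
-- witness is `X ^ e - p` over the Witt vectors of the prime field, with `ULift` adjusting the
-- universe.
theorem nonempty_DVRCat {p e : ℕ} (hp : p.Prime) (he : 1 ≤ e) : Nonempty (DVRCat.{u} p e) := by
  have : Fact p.Prime := ⟨hp⟩
  have : PerfectField (ULift.{u} (ZMod p)) := PerfectField.ofFinite
  have hperf : PerfectRing (ULift.{u} (ZMod p)) p := PerfectField.toPerfectRing p
  exact ⟨⟨CommRingCat.of (AdjoinRoot (eisensteinPoly p e
    (1 : (WittVector p (ULift.{u} (ZMod p)))[X]))), isCompleteMixedCharDVR_adjoinRoot he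
      (by rw [degree_one]; exact_mod_cast he) (by simp)⟩⟩

theorem existsUnique_span_eq {p e : ℕ} (hp : p.Prime) (he : 1 ≤ e) :
    ∃! ν : ℕ, ∀ R : DVRCat.{u} p e, Ideal.span {(e : R.obj)} = maximalIdeal R.obj ^ ν := by
  obtain ⟨s, m, hm, hes⟩ := Nat.exists_eq_pow_mul_and_not_dvd (n := e) (by omega) p hp.ne_one
  have h : ∀ R : DVRCat.{u} p e, Ideal.span {(e : R.obj)} = maximalIdeal R.obj ^ (e * s) :=
    fun R => by
      have := R.property.charP_residueField
      exact span_natCast_eq_pow hm hes R.property.span_natCast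
  obtain ⟨R⟩ := nonempty_DVRCat.{u} hp he
  exact ⟨e * s, h, fun ν hν => pow_maximalIdeal_injective R.obj ((hν R).symm.trans (h R))⟩

end DVRLifting

theorem theorem3p8 (p e : ℕ) (hp : p.Prime) (he : 1 ≤ e) :
    -- the exponent `ν(e)` is well defined and does not depend on the ring
    (∃! ν : ℕ, ∀ R : DVRLifting.DVRCat.{u} p e,
      Ideal.span {(e : R.obj)} = IsLocalRing.maximalIdeal R.obj ^ ν) ∧
    (∀ ν : ℕ, (∀ R : DVRLifting.DVRCat.{u} p e,
        Ideal.span {(e : R.obj)} = IsLocalRing.maximalIdeal R.obj ^ ν) →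
      DVRLifting.IsLiftable.{u} p e (e + e * ν + 1)) ∧
    DVRLifting.liftingNumber.{u} p e < ⊤ := by
  have hν := DVRLifting.existsUnique_span_eq.{u} hp he
  refine ⟨hν, fun ν => DVRLifting.isLiftable_of_span_eq hp he, ?_⟩
  obtain ⟨ν, h, -⟩ := hν
  have hmem : ((e + e * ν + 1 : ℕ) : ℕ∞) ∈
      {N : ℕ∞ | ∃ n : ℕ, DVRLifting.IsLiftable.{u} p e n ∧ N = n} :=
    ⟨_, DVRLifting.isLiftable_of_span_eq hp he h, rfl⟩
  exact (sInf_le hmem).trans_lt (ENat.natCast_lt_top _)
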